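/- Let $n\ge 2$, let $p$ be a real polynomial of degree $m$ on Euclidean space $E^n$ and $Z=\{p=0\}$. Call $p$ oscillatory with respect to $a\in E^n\setminus Z$ if $p$ has $m$ simple zeros on almost every line through $a$; a hyperbolic cavity of $p$ is a maximal (nonempty) connected set $H$ of points with respect to which $p$ is oscillatory. Assume that $Z$ is compact and regular ($\nabla p\ne0$ on $Z$) and that $H$ is a hyperbolic cavity of $p$. Let $\mathrm d\xi/\mathrm dp$ be the quotient form on $Z$, oriented by the outward conormal, i.e. $\mathrm d\xi/\mathrm dp=(\partial_\nu p)^{-1}\mathrm dS$, where $\mathrm dS$ is the surface measure and $\nu=\pm\nabla p/|\nabla p|$ is the unit normal pointing away from $H$ (that is, $\langle\nu(\xi),\xi-a\rangle>0$ for all $a\in H$). Let $\mathrm j=2\pi i$ and let $\mathrm Rf(r,\xi)=\int_{|x-\xi|=r}f\,\mathrm dS$ be the spherical mean transform. The filtered back projection reconstruction formulas for $x\in H$ are, for odd $n$, $$f(x)=-\frac{p(x)}{\mathrm j^{\,n-1}}\int_Z\Big(\frac1r\frac{\partial}{\partial r}\Big)^{n-1}\frac{\mathrm Rf(r,\xi)}{r}\Big|_{r=|x-\xi|}\frac{\mathrm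 d\xi}{\mathrm dp},\tag{A}$$ and, for even $n$, with a principal value integral in $r$, $$f(x)=-\frac{2p(x)}{\mathrm j^{\,n}}\int_Z\Big[\mathrm{p.v.}\!\int_0^\infty\frac{\mathrm d(r^2)}{r^2-|x-\xi|^2}\Big(\frac1r\frac{\partial}{\partial r}\Big)^{n-1}\frac{\mathrm Rf(r,\xi)}{r}\Big]\frac{\mathrm d\xi}{\mathrm dp}.\tag{B}$$ Let $E_{n+1}$ be the forward propagator of the Cauchy problem $$(\partial_t^2-\Delta)u=0,\qquad u(0,x)=0,\quad u_t(0,x)=f(x),$$ given by $$E_{n+1}(t,x)=\frac1{2\pi}\Big(\frac{\partial}{\pi\,\partial t^2}\Big)^{\frac{n-3}2}\theta(t)\,\delta(t^2-|x|^2)\ (n\text{ odd}),\qquad E_{n+1}(t,x)=\frac1{2\pi}\Big(\frac{\partial}{\pi\,\partial t^2}\Big)^{\frac{n-2}2}\frac{\theta(t-|x|)}{(t^2-|x|^2)^{1/2}}\ (n\text{ even}).$$ Let $f$ be a real $C^\infty$ function on $E^n$ with compact support contained in $H$. The time reversal method consists of the following steps: (i) transmission of $f$ to the mirror $\mathbb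 R\times Z$: $u(t,\xi)=\int E_{n+1}(t,x-\xi)f(x)\,\mathrm dx$; (ii) filtration: $v=\mathrm Fu:=-\dfrac{\partial}{\partial t}\dfrac2t\dfrac{\partial}{\partial t}u$; (iii) time reversion $w(t,\xi)=v(-t,\xi)$ of the signal, which is then emitted at times $t<0$, and retransmission to time $0$: $g(x)=\int_Z\int_0^\infty E_{n+1}(t,x-\xi)\,w(-t,\xi)\,\mathrm dt\,\dfrac{\mathrm d\xi}{\mathrm dp}$; (iv) reconstruction: the output is $-2p(x)g(x)$. Then: (1) the function $u(t,y)=\int E_{n+1}(t,x-y)f(x)\,\mathrm dx$, $t>0$, $y\in E^n$, is a classical solution of the Cauchy problem above (it is $C^2$ for $t>0$, and $u$, $u_t$ extend continuously to $t=0$ with values $0$, $f$); (2) the reconstruction formulas are equivalent to the time reversal method: for every $x\in H$ the right-hand side of (A) for odd $n$, respectively of (B) for even $n$, equals the output $-2p(x)g(x)$ of steps (i)–(iv). For even $n$ the principal value in (B) exists for all $x\in H$, $\xi\in Z$. -/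

import Mathlib

open MeasureTheory Set Filter Topology
open scoped ContDiff Gradient RealInnerProductSpace

noncomputable section

namespace TimeReversal

/-- The Euclidean space `Eⁿ`. -/
abbrev Euc (n : ℕ) := EuclideanSpace ℝ (Fin n)

/-! ### Oscillatory polynomials and hyperbolic cavities -/

/-- The function on `Eⁿ` given by a real polynomial in `n` variables. -/
def polyFun {n : ℕ} (p : MvPolynomial (Fin n) ℝ) (x : Euc n) : ℝ :=
  MvPolynomial.eval (fun i => x i) p

/-- The zero set `Z` of `p`. -/
def zeroSet {n : ℕ} (p : MvPolynomial (Fin n) ℝ) : Set (Euc n) :=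
  {x | polyFun p x = 0}

/-- `p` is oscillatory with respect to `a ∉ Z`: on almost every line `{a + t θ}` through `a`
(almost every direction `θ` of the unit sphere) `p` has `m = deg p` simple zeros. -/
def IsOscillatoryAt {n : ℕ} (p : MvPolynomial (Fin n) ℝ) (a : Euc n) : Prop :=
  a ∉ zeroSet p ∧
    ∀ᵐ θ : Metric.sphere (0 : Euc n) 1 ∂(volume : Measure (Euc n)).toSphere,
      {t : ℝ | polyFun p (a + t • (θ : Euc n)) = 0 ∧
        deriv (fun s : ℝ => polyFun p (a + s • (θ : Euc n))) t ≠ 0}.encard = p.totalDegree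

/-- `H` is a hyperbolic cavity of `p`: a (nonempty) maximal connected set of points with respect
to which `p` is oscillatory. -/
def IsHyperbolicCavity {n : ℕ} (p : MvPolynomial (Fin n) ℝ) (H : Set (Euc n)) : Prop :=
  Maximal (fun s : Set (Euc n) => IsConnected s ∧ ∀ a ∈ s, IsOscillatoryAt p a) H

/-- The zero set of `p` is regular: `dp` does not vanish on it. -/
def HasRegularZeroSet {n : ℕ} (p : MvPolynomial (Fin n) ℝ) : Prop :=
  ∀ ξ ∈ zeroSet p, ∇ (polyFun p) ξ ≠ 0

/-! ### The form `dξ/dp` on `Z` -/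

/-- The normal vector `ν` at `ξ` is outward, i.e. it points away from the cavity `H`. -/
def IsOutward {n : ℕ} (H : Set (Euc n)) (ξ ν : Euc n) : Prop :=
  ∀ a ∈ H, 0 < ⟪ν, ξ - a⟫

open Classical in
/-- The density of `dξ/dp` with respect to the surface measure of `Z`, where `Z` is oriented by
the outward conormal: it is `1 / ∂_ν p` for the outward unit normal `ν`, i.e. `± 1 / |∇p|`. -/
def formDensity {n : ℕ} (p : MvPolynomial (Fin n) ℝ) (H : Set (Euc n)) (ξ : Euc n) : ℝ :=
  if IsOutward H ξ (∇ (polyFun p) ξ) then ‖∇ (polyFun p) ξ‖⁻¹ else -‖∇ (polyFun p) ξ‖⁻¹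

/-- The integral `∫_Z φ(ξ) dξ/dp`. -/
def integralForm {n : ℕ} (p : MvPolynomial (Fin n) ℝ) (H : Set (Euc n)) (φ : Euc n → ℝ) : ℝ :=
  ∫ ξ in zeroSet p, φ ξ * formDensity p H ξ
    ∂(Measure.euclideanHausdorffMeasure (n - 1) : Measure (Euc n))

/-! ### Spherical means and the filtered back projection formulas -/

/-- The spherical mean transform `R f(r, ξ) = ∫_{|x - ξ| = r} f dS` (`r > 0`). -/
def sphericalMean {n : ℕ} (f : Euc n → ℝ) (r : ℝ) (ξ : Euc n) : ℝ :=
  r ^ (n - 1) * ∫ θ : Metric.sphere (0 : Euc n) 1, f (ξ + r • (θ : Euc n))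
    ∂(volume : Measure (Euc n)).toSphere

/-- The operator `(1/r) ∂/∂r`. -/
def radialDeriv (h : ℝ → ℝ) (r : ℝ) : ℝ := deriv h r / r

/-- The filtered data `((1/r) ∂/∂r)^{n-1} (R f(r, ξ) / r)`. -/
def filteredData {n : ℕ} (f : Euc n → ℝ) (ξ : Euc n) : ℝ → ℝ :=
  radialDeriv^[n - 1] (fun r => sphericalMean f r ξ / r)

/-- The constant `j = 2πi`. -/
def jConst : ℂ := 2 * Real.pi * Complex.I

/-- The right-hand side of the reconstruction formula for odd `n`. -/
def oddInversion {n : ℕ} (p : MvPolynomial (Fin n) ℝ) (H : Set (Euc n)) (f : Euc n → ℝ)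
    (x : Euc n) : ℂ :=
  -((polyFun p x : ℝ) : ℂ) / jConst ^ (n - 1) *
    ((integralForm p H (fun ξ => filteredData f ξ ‖x - ξ‖) : ℝ) : ℂ)

/-- The integral of `h(r) d(r²) / (r² - ρ²)` over `r > 0`, `|r² - ρ²| ≥ ε`. -/
def truncatedIntegral (h : ℝ → ℝ) (ρ ε : ℝ) : ℝ :=
  ∫ r in {r : ℝ | 0 < r ∧ ε ≤ |r ^ 2 - ρ ^ 2|}, h r * (2 * r) / (r ^ 2 - ρ ^ 2)

/-- The principal value of `∫₀^∞ h(r) d(r²) / (r² - ρ²)`. -/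
def principalValue (h : ℝ → ℝ) (ρ : ℝ) : ℝ :=
  limUnder (𝓝[>] (0 : ℝ)) (truncatedIntegral h ρ)

/-- The right-hand side of the reconstruction formula for even `n`. -/
def evenInversion {n : ℕ} (p : MvPolynomial (Fin n) ℝ) (H : Set (Euc n)) (f : Euc n → ℝ)
    (x : Euc n) : ℂ :=
  -(2 * ((polyFun p x : ℝ) : ℂ)) / jConst ^ n *
    ((integralForm p H (fun ξ => principalValue (filteredData f ξ) ‖x - ξ‖) : ℝ) : ℂ)

/-! ### The wave equation and its forward propagator -/

/-- `u` is a classical solution for `t > 0` of `(∂²/∂t² - Δ) u = 0` with initial data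
`u(0, x) = 0`, `u_t(0, x) = f(x)`, the data being attained continuously. -/
structure IsCauchySolution {n : ℕ} (f : Euc n → ℝ) (u : ℝ → Euc n → ℝ) : Prop where
  contDiffOn : ContDiffOn ℝ 2 (fun q : ℝ × Euc n => u q.1 q.2) (Ioi 0 ×ˢ univ)
  wave : ∀ t > 0, ∀ y, iteratedDeriv 2 (fun s => u s y) t = Laplacian.laplacian (u t) y
  initial : ∀ y, Tendsto (fun q : ℝ × Euc n => u q.1 q.2) (𝓝[Ioi 0 ×ˢ univ] (0, y)) (𝓝 0)
  initial_deriv : ∀ y, Tendsto (fun q : ℝ × Euc n => deriv (fun s => u s q.2) q.1)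
    (𝓝[Ioi 0 ×ˢ univ] (0, y)) (𝓝 (f y))

/-- The forward propagator is `E_{n+1}(t, x) = θ(t) K(t² - |x|²)`, where `K` is the distribution
on the line
* `K = (1/2π) (π⁻¹ d/ds)^{(n-3)/2} δ(s)` for odd `n ≥ 3`,
* `K = (1/2π) (π⁻¹ d/ds)^{(n-2)/2} s₊^{-1/2}` for even `n ≥ 2`.

This is the value `⟨K, φ⟩`; the derivatives are distributional, hence fall on `φ` with the sign
`(-1)^k`. (For odd `n` the truncated quotient `(n - 2) / 2` is `(n - 3) / 2`.) -/
def propagatorKernel (n : ℕ) (φ : ℝ → ℝ) : ℝ :=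
  1 / (2 * Real.pi) * (-1 / Real.pi) ^ ((n - 2) / 2) *
    if Odd n then iteratedDeriv ((n - 2) / 2) φ 0
    else ∫ s in Ioi (0 : ℝ), iteratedDeriv ((n - 2) / 2) φ s / √s

/-- `∫ E_{n+1}(t, x - y) f(x) dx`: the kernel `K` is evaluated on the density
`R f(r, y) / (2 r)`, `r = (t² - s)^{1/2}`, of the image of `f(x) dx` under the map
`x ↦ s = t² - |x - y|²`; this density vanishes for `s ≥ t²`. -/
def transmit {n : ℕ} (f : Euc n → ℝ) (t : ℝ) (y : Euc n) : ℝ :=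
  if 0 < t then
    propagatorKernel n (fun s => sphericalMean f √(t ^ 2 - s) y / (2 * √(t ^ 2 - s)))
  else 0

/-- `∫₀^∞ E_{n+1}(t, z) w(t) dt` for `z ≠ 0`: the kernel `K` is evaluated on the density
`w(t) / (2 t)`, `t = (|z|² + s)^{1/2}`, of the image of `w(t) dt` under the map
`t ↦ s = t² - |z|²`. -/
def propagatorIntegral (n : ℕ) (w : ℝ → ℝ) (z : Euc n) : ℝ :=
  propagatorKernel n (fun s => w √(‖z‖ ^ 2 + s) / (2 * √(‖z‖ ^ 2 + s)))

/-! ### The time reversal method -/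

/-- The filtration `F u = -∂/∂t (2/t) ∂u/∂t`. -/
def filtration (u : ℝ → ℝ) (t : ℝ) : ℝ :=
  -deriv (fun s => 2 / s * deriv u s) t

/-- Time reversion of a signal on `ℝ × Z`. -/
def reversal {n : ℕ} (v : ℝ → Euc n → ℝ) (t : ℝ) (ξ : Euc n) : ℝ := v (-t) ξ

/-- Retransmission of a signal `w(t, ξ)`, `t < 0`, emitted on `Z`, observed at the time `0`:
`∫_Z ∫₀^∞ E_{n+1}(t, x - ξ) w(-t, ξ) dt dξ/dp`. -/
def retransmit {n : ℕ} (p : MvPolynomial (Fin n) ℝ) (H : Set (Euc n)) (w : ℝ → Euc n → ℝ)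
    (x : Euc n) : ℝ :=
  integralForm p H (fun ξ => propagatorIntegral n (fun t => w (-t) ξ) (x - ξ))

/-- The filtered signal `v(t, ξ) = F u(t, ξ)`, where `u` is the transmitted signal. -/
def filteredSignal {n : ℕ} (f : Euc n → ℝ) (t : ℝ) (ξ : Euc n) : ℝ :=
  filtration (fun s => transmit f s ξ) t

/-- The output of the time reversal method applied to `f`: transmission, filtration, time
reversion and retransmission, multiplication by `-2 p(x)`. -/
def timeReversal {n : ℕ} (p : MvPolynomial (Fin n) ℝ) (H : Set (Euc n)) (f : Euc n → ℝ)
    (x : Euc n) : ℝ :=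
  -2 * polyFun p x * retransmit p H (reversal (filteredSignal f)) x

end TimeReversal

end

open TimeReversal

noncomputable section

namespace TimeReversal

/-! ### Smooth dependence of integrals on parameters -/

section Parametric

variable {S Θ P : Type} [MetricSpace S] [CompactSpace S] [MeasurableSpace S]
  [OpensMeasurableSpace S] [NormedAddCommGroup Θ] [NormedSpace ℝ Θ]
  [NormedAddCommGroup P] [NormedSpace ℝ P] [FiniteDimensional ℝ P]

/-! Everything is read in the variable `σ = r²`. Put `q(σ) = Rf(√σ, ξ)/√σ` (`rootMean`) and `k =
⌊(n-2)/2⌋`.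

The equivalence holds for each mirror point `ξ` separately. Since `H` misses `Z`, `ξ` lies off the
support of `f`, so `q` is smooth with compact support and vanishes near `σ ≤ 0`. As `(1/r)∂_r = 2
d/dσ`, the filtered data is `2^(n-1) q^(n-1)(r²)` (`filteredData_eq`). Transmission gives `c (A
q^(k))(t²)`, with `A` the identity for odd `n` and the Abel integral for even `n` (`transmit_eq`);
filtration is `-8t d²/dσ²` (`filteredSignal_eq`), and its factor `t` cancels against the `1/(2t)` of
the retransmission. For odd `n`, retransmission adds `k` derivatives, in all `2k+2 = n-1`, at
`|x-ξ|²`. For even `n` it adds `k` derivatives and a second half-order integral running the other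
way. Two opposite half-order integrals of a derivative `h'` make the principal value of `h(z)/z`
(`integral_abel_deriv`): integrating the product of the kernels first leaves `-log|y|`, and
integration by parts turns this into `1/y`. The constants combine into powers of `j² = -4π²`.

For the Cauchy problem, the spherical average satisfies the Euler–Poisson–Darboux equation with `a =
n-1` (`darboux`). Each derivative in `σ` demanded by the propagator lowers `a` by two
(`IsEPD.raise`), ending at `a = 2` for odd `n` and `a = 1` for even `n`; the Abel integral then
raises `1` to `2` (`isEPD_descent`). A solution `V` with `a = 2` gives the wave `tV`, whose initial
velocity is `V(0, ·)`; the area of the sphere identifies it with `f`. -/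

theorem hasFDerivAt_integral_of_contDiff {F : Type} [NormedAddCommGroup F] [NormedSpace ℝ F]
    (μ : Measure S) [IsFiniteMeasure μ] {ι : S → Θ} (hι : Continuous ι)
    {G : P × Θ → F} (hG : ContDiff ℝ ∞ G) (q : P) :
    HasFDerivAt (fun q => ∫ s, G (q, ι s) ∂μ)
      (∫ s, (fderiv ℝ G (q, ι s)).comp (ContinuousLinearMap.inl ℝ P Θ) ∂μ) q := by
  have hG' : Continuous (fderiv ℝ G) := hG.continuous_fderiv (by simp)
  have hcont : Continuous fun z : P × S =>
      (fderiv ℝ G (z.1, ι z.2)).comp (ContinuousLinearMap.inl ℝ P Θ) :=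
    (hG'.comp (continuous_fst.prodMk (hι.comp continuous_snd))).clm_comp continuous_const
  -- `P` is finite dimensional and `S` compact, so the partial derivative is bounded on ball × `S`;
  -- this constant is the dominating function.
  obtain ⟨C, hC⟩ := ((isCompact_closedBall q 1).prod (isCompact_univ (X := S))).exists_bound_of_continuousOn
    hcont.continuousOn
  have hslice : ∀ x, Continuous fun s => G (x, ι s) := fun x =>
    hG.continuous.comp (continuous_const.prodMk hι)
  refine hasFDerivAt_integral_of_dominated_of_fderiv_le (𝕜 := ℝ) (μ := μ)
    (F := fun q s => G (q, ι s)) (F' := fun q s =>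
      (fderiv ℝ G (q, ι s)).comp (ContinuousLinearMap.inl ℝ P Θ)) (bound := fun _ => C)
    (Metric.closedBall_mem_nhds q one_pos) (Eventually.of_forall fun x => ?_) ?_ ?_ ?_
    (integrable_const (μ := μ) C) ?_
  · exact (hslice x).aestronglyMeasurable
  · exact (hslice q).integrable_of_hasCompactSupport (HasCompactSupport.of_compactSpace _)
  · exact (hcont.comp (continuous_const.prodMk continuous_id)).aestronglyMeasurable
  · exact Eventually.of_forall fun s x hx => hC (x, s) ⟨hx, mem_univ _⟩
  · refine Eventually.of_forall fun s x _ => ?_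
    exact ((hG.differentiable (by simp) (x, ι s)).hasFDerivAt).comp x (hasFDerivAt_prodMk_left x (ι s))

/-- The target `F` is quantified inside the induction because the derivative is an integral of the
same kind with values in `P →L[ℝ] F`. -/
theorem contDiff_integral_nat (μ : Measure S) [IsFiniteMeasure μ] {ι : S → Θ} (hι : Continuous ι)
    (m : ℕ) : ∀ {F : Type} [NormedAddCommGroup F] [NormedSpace ℝ F]
    {G : P × Θ → F}, ContDiff ℝ ∞ G → ContDiff ℝ m (fun q => ∫ s, G (q, ι s) ∂μ) := by
  induction m with
  | zero =>
    intro F _ _ G hG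
    exact contDiff_zero.2 <| continuous_iff_continuousAt.2 fun q =>
      (hasFDerivAt_integral_of_contDiff μ hι hG q).continuousAt
  | succ m ih =>
    intro F _ _ G hG
    refine (contDiff_succ_iff_hasFDerivAt (n := (m : ℕ))).2
      ⟨_, ih (G := fun z => (fderiv ℝ G z).comp (ContinuousLinearMap.inl ℝ P Θ)) ?_,
        hasFDerivAt_integral_of_contDiff μ hι hG⟩
    exact (hG.fderiv_right (by simp)).clm_comp contDiff_const

theorem contDiff_integral {F : Type} [NormedAddCommGroup F] [NormedSpace ℝ F]
    (μ : Measure S) [IsFiniteMeasure μ] {ι : S → Θ} (hι : Continuous ι)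
    {G : P × Θ → F} (hG : ContDiff ℝ ∞ G) : ContDiff ℝ ∞ (fun q => ∫ s, G (q, ι s) ∂μ) :=
  contDiff_infty.2 fun m => contDiff_integral_nat μ hι m hG

end Parametric

/-! ### Directional derivatives -/

section DirDeriv

variable {V W : Type} [NormedAddCommGroup V] [NormedSpace ℝ V] [NormedAddCommGroup W]
  [NormedSpace ℝ W]

/-- The derivative of `G` in the direction of the constant vector field `v`. -/
def dirDeriv (v : V) (G : V → ℝ) (q : V) : ℝ := fderiv ℝ G q v

theorem contDiff_dirDeriv {G : V → ℝ} (hG : ContDiff ℝ ∞ G) (v : V) :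
    ContDiff ℝ ∞ (dirDeriv v G) :=
  (hG.fderiv_right (by simp)).clm_apply contDiff_const

theorem dirDeriv_comm {G : V → ℝ} (hG : ContDiff ℝ ∞ G) (v w : V) :
    dirDeriv v (dirDeriv w G) = dirDeriv w (dirDeriv v G) := by
  have key : ∀ (v w q : V), dirDeriv v (dirDeriv w G) q = fderiv ℝ (fderiv ℝ G) q v w := by
    intro v w q
    have h : DifferentiableAt ℝ (fderiv ℝ G) q :=
      (hG.fderiv_right (m := ∞) (by simp)).differentiable (by simp) q
    change fderiv ℝ (fun z => fderiv ℝ G z w) q v = _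
    rw [fderiv_clm_apply h (differentiableAt_const w)]
    simp
  funext q
  rw [key, key]
  exact ((contDiff_infty.1 hG 2).contDiffAt.isSymmSndFDerivAt (by simp)) v w

theorem dirDeriv_const_mul (v : V) (c : ℝ) {G : V → ℝ} (hG : ContDiff ℝ ∞ G) :
    dirDeriv v (fun q => c * G q) = fun q => c * dirDeriv v G q := by
  funext q
  simp [dirDeriv, fderiv_const_mul (hG.differentiable (by simp) q)]

theorem dirDeriv_comp_add (v : W) (L : V →L[ℝ] W) (w : V) (c : W) (h : L w = v)
    {G : W → ℝ} (hG : ContDiff ℝ ∞ G) (q : V) :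
    dirDeriv w (fun z => G (c + L z)) q = dirDeriv v G (c + L q) := by
  have h1 : HasFDerivAt (fun z => c + L z) L q := L.hasFDerivAt.const_add c
  have h2 := ((hG.differentiable (by simp) (c + L q)).hasFDerivAt).comp q h1
  simp only [dirDeriv]
  rw [show (fun z => G (c + L z)) = G ∘ (fun z => c + L z) from rfl, h2.fderiv]
  simp [h]

theorem hasDerivAt_line {G : V → ℝ} (hG : ContDiff ℝ ∞ G) {γ : ℝ → V} {v : V} {t : ℝ}
    (hγ : HasDerivAt γ v t) : HasDerivAt (fun s => G (γ s)) (dirDeriv v G (γ t)) t :=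
  ((hG.differentiable (by simp) (γ t)).hasFDerivAt).comp_hasDerivAt t hγ

theorem dirDeriv_integral {S : Type} [MetricSpace S] [CompactSpace S] [MeasurableSpace S]
    [OpensMeasurableSpace S] [FiniteDimensional ℝ V] (μ : Measure S) [IsFiniteMeasure μ]
    {ι : S → W} (hι : Continuous ι) {G : V × W → ℝ} (hG : ContDiff ℝ ∞ G) (v q : V) :
    dirDeriv v (fun q => ∫ s, G (q, ι s) ∂μ) q = ∫ s, dirDeriv (v, 0) G (q, ι s) ∂μ := by
  have hcont : Continuous fun s : S =>
      (fderiv ℝ G (q, ι s)).comp (ContinuousLinearMap.inl ℝ V W) :=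
    ((hG.continuous_fderiv (by simp)).comp (continuous_const.prodMk hι)).clm_comp continuous_const
  rw [dirDeriv, (hasFDerivAt_integral_of_contDiff μ hι hG q).fderiv,
    ContinuousLinearMap.integral_apply
      (hcont.integrable_of_hasCompactSupport (HasCompactSupport.of_compactSpace _))]
  simp [dirDeriv]

theorem dirDeriv_eq_sum {n : ℕ} (v : Euc n) (g : Euc n → ℝ) (z : Euc n) :
    dirDeriv v g z = ∑ i, v i * dirDeriv (EuclideanSpace.basisFun (Fin n) ℝ i) g z := by
  conv_lhs => rw [dirDeriv, ← (EuclideanSpace.basisFun (Fin n) ℝ).sum_repr v]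
  simp [dirDeriv, map_sum]

/-- The Laplacian on `Eⁿ` as a sum of repeated directional derivatives. -/
theorem laplacian_eq_sum_dirDeriv {n : ℕ} {g : Euc n → ℝ} (hg : ContDiff ℝ ∞ g) (y : Euc n) :
    Laplacian.laplacian g y = ∑ i, dirDeriv (EuclideanSpace.basisFun (Fin n) ℝ i)
      (dirDeriv (EuclideanSpace.basisFun (Fin n) ℝ i) g) y := by
  rw [InnerProductSpace.laplacian_eq_iteratedFDeriv_orthonormalBasis g
    (EuclideanSpace.basisFun (Fin n) ℝ)]
  refine Finset.sum_congr rfl fun i _ => ?_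
  have h : DifferentiableAt ℝ (fderiv ℝ g) y :=
    (hg.fderiv_right (m := ∞) (by simp)).differentiable (by simp) y
  rw [iteratedFDeriv_two_apply]
  change _ = fderiv ℝ (fun z => fderiv ℝ g z _) y _
  rw [fderiv_clm_apply h (differentiableAt_const _)]
  simp

end DirDeriv

/-! ### Rotation invariance of the sphere and the Darboux equation -/

/-- The surface measure of the unit sphere. -/
abbrev sphereMeasure (n : ℕ) : Measure (Metric.sphere (0 : Euc n) 1) :=
  (volume : Measure (Euc n)).toSphere

open scoped Pointwise in
-- The surface measure of `s` is a multiple of the volume of the cone `(0,1) • s`, and a linear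
-- isometry carries cones to cones and preserves volume.
theorem integral_sphere_comp_isometry {n : ℕ} (R : Euc n ≃ₗᵢ[ℝ] Euc n) (h : Euc n → ℝ) :
    ∫ θ, h (R (θ : Euc n)) ∂sphereMeasure n = ∫ θ, h (θ : Euc n) ∂sphereMeasure n := by
  let e : Metric.sphere (0 : Euc n) 1 ≃ₜ Metric.sphere (0 : Euc n) 1 :=
    R.toHomeomorph.subtype fun x => by simp
  have hcoe : ∀ θ, ((e θ : Metric.sphere (0 : Euc n) 1) : Euc n) = R θ := fun θ => rfl
  have he : MeasurePreserving e (sphereMeasure n) (sphereMeasure n) := by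
    refine ⟨e.continuous.measurable, Measure.ext fun s hs => ?_⟩
    rw [Measure.map_apply e.continuous.measurable hs, Measure.toSphere_apply' _ hs,
      Measure.toSphere_apply' _ (e.continuous.measurable hs)]
    congr 1
    have hpre : Ioo (0 : ℝ) 1 • (Subtype.val '' (e ⁻¹' s))
        = R ⁻¹' (Ioo (0 : ℝ) 1 • (Subtype.val '' s)) := by
      ext x
      simp only [Set.mem_smul, mem_image, mem_preimage, exists_exists_and_eq_and]
      constructor
      · rintro ⟨a, ha, θ, hθ, rfl⟩
        exact ⟨a, ha, e θ, hθ, by simp [hcoe]⟩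
      · rintro ⟨a, ha, θ, hθ, hx⟩
        refine ⟨a, ha, e.symm θ, by simpa using hθ, R.injective ?_⟩
        rw [← hx, map_smul, ← hcoe, e.apply_symm_apply]
    rw [hpre]
    exact R.measurePreserving.measure_preimage_emb R.toHomeomorph.measurableEmbedding _
  exact he.integral_comp e.measurableEmbedding (fun θ : Metric.sphere (0 : Euc n) 1 => h (θ : Euc n))

/-- The vector field generates the rotations of the `(u, w)`-plane. The integral of `H` composed
with a rotation does not depend on the angle, so its derivative vanishes. -/
theorem integral_sphere_rotation {n : ℕ} {H : Euc n → ℝ} (hH : ContDiff ℝ ∞ H) {u w : Euc n}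
    (hu : ‖u‖ = 1) (hw : ‖w‖ = 1) (huw : ⟪u, w⟫ = 0) :
    ∫ θ, dirDeriv (⟪u, (θ : Euc n)⟫ • w - ⟪w, (θ : Euc n)⟫ • u) H (θ : Euc n) ∂sphereMeasure n
      = 0 := by
  have huu : ⟪u, u⟫ = 1 := by rw [real_inner_self_eq_norm_sq, hu, one_pow]
  have hww : ⟪w, w⟫ = 1 := by rw [real_inner_self_eq_norm_sq, hw, one_pow]
  have hwu : ⟪w, u⟫ = 0 := by rw [real_inner_comm, huw]
  let v : ℝ → Euc n := fun t => Real.cos t • u + Real.sin t • w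
  have hv : ∀ t, ‖v t‖ = 1 := by
    intro t
    have : ‖v t‖ ^ 2 = 1 := by
      rw [← real_inner_self_eq_norm_sq]
      simp only [v, inner_add_left, inner_add_right, inner_smul_left, inner_smul_right, huu, hww,
        huw, hwu]
      simp
      nlinarith [Real.sin_sq_add_cos_sq t]
    nlinarith [norm_nonneg (v t)]
  -- The rotation is obtained as a product of two reflections in lines: `ρ t ∘ ρ 0` turns the `(u,
  -- w)`-plane by the angle `2t` and fixes its orthogonal complement. Hence the factor 2 in `h1`.
  let ρ : ℝ → Euc n → Euc n := fun t x => (2 * ⟪v t, x⟫) • v t - x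
  have hρ : ∀ t x, (ℝ ∙ v t).reflection x = ρ t x := by
    intro t x
    rw [Submodule.reflection_singleton_apply, hv]
    simp [ρ, mul_smul, two_smul]
  let G : ℝ × Euc n → ℝ := fun z => H (ρ z.1 (ρ 0 z.2))
  have hG : ContDiff ℝ ∞ G := by
    refine hH.comp ?_
    simp only [ρ, v]
    have h1 : ContDiff ℝ ∞ (fun z : ℝ × Euc n => Real.cos z.1) := Real.contDiff_cos.comp contDiff_fst
    have h2 : ContDiff ℝ ∞ (fun z : ℝ × Euc n => Real.sin z.1) := Real.contDiff_sin.comp contDiff_fst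
    have h3 : ContDiff ℝ ∞ (fun z : ℝ × Euc n => Real.cos z.1 • u + Real.sin z.1 • w) := by fun_prop
    have h4 : ContDiff ℝ ∞ (fun z : ℝ × Euc n => (2 * ⟪v 0, z.2⟫) • v 0 - z.2) :=
      ((contDiff_const.mul (contDiff_const.inner ℝ contDiff_snd)).smul contDiff_const).sub contDiff_snd
    exact ((contDiff_const.mul (h3.inner ℝ h4)).smul h3).sub h4
  have hconst : ∀ t, ∫ θ, G (t, (θ : Metric.sphere (0 : Euc n) 1)) ∂sphereMeasure n
      = ∫ θ, H (θ : Euc n) ∂sphereMeasure n := by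
    intro t
    rw [← integral_sphere_comp_isometry (((ℝ ∙ v 0).reflection).trans (ℝ ∙ v t).reflection) H]
    simp only [LinearIsometryEquiv.trans_apply, hρ, G]
  have h0 := dirDeriv_integral (sphereMeasure n) continuous_subtype_val hG 1 0
  simp only [hconst] at h0
  have h1 : ∀ θ : Euc n, dirDeriv ((1 : ℝ), (0 : Euc n)) G (0, θ)
      = 2 * dirDeriv (⟪u, θ⟫ • w - ⟪w, θ⟫ • u) H θ := by
    intro θ
    have hv0 : v 0 = u := by simp [v]
    have hρ0 : ρ 0 θ = (2 * ⟪u, θ⟫) • u - θ := by simp [ρ, hv0]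
    have hvd : HasDerivAt v w 0 := by
      exact (((Real.hasDerivAt_cos 0).smul_const u).add
        ((Real.hasDerivAt_sin 0).smul_const w)).congr_deriv (by simp)
    have hρd : HasDerivAt (fun t => ρ t (ρ 0 θ)) ((2 : ℝ) • (⟪u, θ⟫ • w - ⟪w, θ⟫ • u)) 0 := by
      have h := (((hvd.inner ℝ (hasDerivAt_const 0 (ρ 0 θ))).const_mul 2).smul hvd).sub_const (ρ 0 θ)
      refine h.congr_deriv ?_
      rw [hv0, hρ0]
      simp only [inner_sub_right, inner_smul_right, huu, hwu, inner_zero_right]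
      module
    have hρρ : ρ 0 (ρ 0 θ) = θ := by
      rw [← hρ 0, ← hρ 0, Submodule.reflection_reflection]
    have hline : HasDerivAt (fun t : ℝ => (t, θ)) ((1 : ℝ), (0 : Euc n)) 0 :=
      (hasDerivAt_id 0).prodMk (hasDerivAt_const 0 θ)
    have ha := hasDerivAt_line hG hline
    have hb := hasDerivAt_line hH hρd
    rw [hρρ] at hb
    rw [ha.unique hb, dirDeriv, dirDeriv, map_smul, smul_eq_mul]
  simp only [h1] at h0
  rw [integral_const_mul] at h0
  have h2 : dirDeriv (1 : ℝ) (fun _ : ℝ => ∫ θ, H (θ : Euc n) ∂sphereMeasure n) 0 = 0 := by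
    simp [dirDeriv]
  linarith

/-- The integral of `f` over the sphere of radius `r` about `y`, with respect to the surface
measure of the unit sphere; `q = (r, y)`. -/
def sphAvg {n : ℕ} (f : Euc n → ℝ) (q : ℝ × Euc n) : ℝ :=
  ∫ θ, f (q.2 + q.1 • (θ : Euc n)) ∂sphereMeasure n

/-- The radial unit vector of `ℝ × Eⁿ`. -/
abbrev radial (n : ℕ) : ℝ × Euc n := (1, 0)

/-- The `i`-th standard unit vector of `Eⁿ`. -/
abbrev unitVec {n : ℕ} (i : Fin n) : Euc n := EuclideanSpace.basisFun (Fin n) ℝ i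

theorem contDiff_sphAvg_integrand {n : ℕ} {f : Euc n → ℝ} (hf : ContDiff ℝ ∞ f) :
    ContDiff ℝ ∞ (fun z : (ℝ × Euc n) × Euc n => f (z.1.2 + z.1.1 • z.2)) :=
  hf.comp (by fun_prop)

theorem contDiff_sphAvg {n : ℕ} {f : Euc n → ℝ} (hf : ContDiff ℝ ∞ f) :
    ContDiff ℝ ∞ (sphAvg f) :=
  contDiff_integral (sphereMeasure n) continuous_subtype_val (contDiff_sphAvg_integrand hf)

theorem dirDeriv_sphAvg_space {n : ℕ} {f : Euc n → ℝ} (hf : ContDiff ℝ ∞ f) (v : Euc n) :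
    dirDeriv ((0 : ℝ), v) (sphAvg f) = sphAvg (dirDeriv v f) := by
  funext q
  refine (dirDeriv_integral (sphereMeasure n) continuous_subtype_val
    (contDiff_sphAvg_integrand hf) (0, v) q).trans (integral_congr_ae (Eventually.of_forall fun θ => ?_))
  have hγ : HasDerivAt (fun s : ℝ => ((q.1, q.2 + s • v), (θ : Euc n)))
      (((0 : ℝ), v), (0 : Euc n)) 0 := by
    refine ((hasDerivAt_const _ _).prodMk ?_).prodMk (hasDerivAt_const _ _)
    exact (((hasDerivAt_id (0 : ℝ)).smul_const v).const_add q.2).congr_deriv (by simp)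
  have hγ' : HasDerivAt (fun s : ℝ => (q.2 + s • v) + q.1 • (θ : Euc n)) v 0 := by
    exact ((((hasDerivAt_id (0 : ℝ)).smul_const v).const_add q.2).add_const _).congr_deriv (by simp)
  have h := (hasDerivAt_line (contDiff_sphAvg_integrand hf) hγ).unique (hasDerivAt_line hf hγ')
  simpa using h

theorem dirDeriv_radial_integral {n : ℕ} {f : Fin n → Euc n → ℝ} (hf : ∀ i, ContDiff ℝ ∞ (f i))
    {c : Fin n → Euc n → ℝ} (hc : ∀ i, ContDiff ℝ ∞ (c i)) (q : ℝ × Euc n) :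
    dirDeriv (radial n) (fun q => ∫ θ, ∑ i, c i (θ : Euc n) * f i (q.2 + q.1 • (θ : Euc n))
      ∂sphereMeasure n) q
      = ∫ θ, ∑ i, c i (θ : Euc n) * dirDeriv (θ : Euc n) (f i) (q.2 + q.1 • (θ : Euc n))
        ∂sphereMeasure n := by
  have hG : ContDiff ℝ ∞ (fun z : (ℝ × Euc n) × Euc n =>
      ∑ i, c i z.2 * f i (z.1.2 + z.1.1 • z.2)) :=
    ContDiff.sum fun i _ => ((hc i).comp contDiff_snd).mul (contDiff_sphAvg_integrand (hf i))
  refine (dirDeriv_integral (sphereMeasure n) continuous_subtype_val hG (radial n) q).trans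
    (integral_congr_ae (Eventually.of_forall fun θ => ?_))
  have hγ : HasDerivAt (fun s : ℝ => ((q.1 + s, q.2), (θ : Euc n)))
      (((1 : ℝ), (0 : Euc n)), (0 : Euc n)) 0 :=
    (((hasDerivAt_id (0 : ℝ)).const_add q.1).prodMk (hasDerivAt_const _ _)).prodMk
      (hasDerivAt_const _ _)
  have hγ' : HasDerivAt (fun s : ℝ => q.2 + (q.1 + s) • (θ : Euc n)) (θ : Euc n) 0 := by
    exact ((((hasDerivAt_id (0 : ℝ)).const_add q.1).smul_const (θ : Euc n)).const_add
      q.2).congr_deriv (by simp)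
  have h := (hasDerivAt_line hG hγ).unique (HasDerivAt.fun_sum fun i _ =>
    (hasDerivAt_line (hf i) hγ').const_mul (c i θ))
  simpa using h

theorem dirDeriv_radial_sphAvg {n : ℕ} {f : Euc n → ℝ} (hf : ContDiff ℝ ∞ f) :
    dirDeriv (radial n) (sphAvg f) = fun q => ∫ θ, ∑ i, (θ : Euc n) i *
      dirDeriv (unitVec i) f (q.2 + q.1 • (θ : Euc n)) ∂sphereMeasure n := by
  funext q
  refine (dirDeriv_integral (sphereMeasure n) continuous_subtype_val
    (contDiff_sphAvg_integrand hf) (radial n) q).trans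
    (integral_congr_ae (Eventually.of_forall fun θ => ?_))
  have hγ : HasDerivAt (fun s : ℝ => ((q.1 + s, q.2), (θ : Euc n)))
      (((1 : ℝ), (0 : Euc n)), (0 : Euc n)) 0 :=
    (((hasDerivAt_id (0 : ℝ)).const_add q.1).prodMk (hasDerivAt_const _ _)).prodMk
      (hasDerivAt_const _ _)
  have hγ' : HasDerivAt (fun s : ℝ => q.2 + (q.1 + s) • (θ : Euc n)) (θ : Euc n) 0 := by
    exact ((((hasDerivAt_id (0 : ℝ)).const_add q.1).smul_const (θ : Euc n)).const_add
      q.2).congr_deriv (by simp)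
  have h := (hasDerivAt_line (contDiff_sphAvg_integrand hf) hγ).unique (hasDerivAt_line hf hγ')
  rw [dirDeriv_eq_sum (θ : Euc n)] at h
  simpa using h

/-- The sum `∑ ∂ᵢ² f`. -/
def lap {n : ℕ} (f : Euc n → ℝ) (x : Euc n) : ℝ :=
  ∑ i, dirDeriv (unitVec i) (dirDeriv (unitVec i) f) x

theorem contDiff_lap {n : ℕ} {f : Euc n → ℝ} (hf : ContDiff ℝ ∞ f) : ContDiff ℝ ∞ (lap f) :=
  ContDiff.sum fun _ _ => contDiff_dirDeriv (contDiff_dirDeriv hf _) _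

theorem integrable_sphere_of_continuous {n : ℕ} {g : Euc n → ℝ} (hg : Continuous g) :
    Integrable (fun θ : Metric.sphere (0 : Euc n) 1 => g θ) (sphereMeasure n) :=
  (hg.comp continuous_subtype_val).integrable_of_hasCompactSupport
    (HasCompactSupport.of_compactSpace _)

/-- The Darboux equation for spherical means. -/
theorem darboux {n : ℕ} {f : Euc n → ℝ} (hf : ContDiff ℝ ∞ f) (q : ℝ × Euc n) :
    q.1 * dirDeriv (radial n) (dirDeriv (radial n) (sphAvg f)) q
      + (n - 1) * dirDeriv (radial n) (sphAvg f) q = q.1 * sphAvg (lap f) q := by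
  have hfi : ∀ i, ContDiff ℝ ∞ (dirDeriv (unitVec i) f) := fun i => contDiff_dirDeriv hf _
  have hcoord : ∀ i, ContDiff ℝ ∞ (fun x : Euc n => x i) := fun i => by fun_prop
  let φ : Fin n → Euc n → ℝ := fun j x => dirDeriv (unitVec j) f (q.2 + q.1 • x)
  let φ₂ : Fin n → Fin n → Euc n → ℝ := fun i j x =>
    dirDeriv (unitVec i) (dirDeriv (unitVec j) f) (q.2 + q.1 • x)
  have hφ : ∀ j, ContDiff ℝ ∞ (φ j) := fun j => (hfi j).comp (by fun_prop)
  have hφ₂ : ∀ i j, ContDiff ℝ ∞ (φ₂ i j) := fun i j =>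
    (contDiff_dirDeriv (hfi j) _).comp (by fun_prop)
  -- On the sphere, `X i j` is the derivative of `x_i φ_j` along the rotation field `x_i e_j - x_j
  -- e_i`, so its integral vanishes. By `∑ x_i² = 1`, the sum over `i, j` is `r Δf` minus the
  -- integrands of `(n-1) M_r` and `r M_rr`.
  let X : Fin n → Fin n → Euc n → ℝ := fun i j x =>
    (if i = j then x i * φ j x else 0) - x j * φ j x
      + q.1 * (x i ^ 2 * φ₂ j j x - x i * x j * φ₂ i j x)
  have hX : ∀ i j, ∫ θ, X i j (θ : Euc n) ∂sphereMeasure n = 0 := by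
    intro i j
    by_cases hij : i = j
    · subst hij
      simp only [X, if_true]
      rw [← integral_zero (Metric.sphere (0 : Euc n) 1) ℝ (μ := sphereMeasure n)]
      congr 1
      funext θ
      ring
    · have hH : ContDiff ℝ ∞ (fun x : Euc n => x i * φ j x) := (hcoord i).mul (hφ j)
      have hon := (EuclideanSpace.basisFun (Fin n) ℝ).orthonormal
      have h := integral_sphere_rotation hH (hon.1 i) (hon.1 j) (hon.2 hij)
      rw [← h]
      congr 1
      funext θ
      set x : Euc n := (θ : Euc n)
      set v : Euc n := ⟪unitVec i, x⟫ • unitVec j - ⟪unitVec j, x⟫ • unitVec i with hv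
      have hγ : HasDerivAt (fun s : ℝ => x + s • v) v 0 :=
        (((hasDerivAt_id (0 : ℝ)).smul_const v).const_add x).congr_deriv (by simp)
      have hγi : HasDerivAt (fun s : ℝ => (x + s • v) i) (v i) 0 := by
        have := ((hasDerivAt_id (0 : ℝ)).mul_const (v i)).const_add (x i)
        exact (this.congr_deriv (by simp))
      have hγj : HasDerivAt (fun s : ℝ => q.2 + q.1 • (x + s • v)) (q.1 • v) 0 :=
        (hγ.const_smul q.1).const_add q.2
      have h1 := (hasDerivAt_line hH hγ).unique (hγi.mul (hasDerivAt_line (hfi j) hγj))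
      simp only [zero_smul, add_zero] at h1
      have h2 : dirDeriv (q.1 • v) (dirDeriv (unitVec j) f) (q.2 + q.1 • x)
          = q.1 * (x i * φ₂ j j x - x j * φ₂ i j x) := by
        rw [hv]
        simp [dirDeriv, φ₂, map_sub, map_smul, PiLp.inner_apply]
      have h3 : v i = - x j := by
        rw [hv]
        simp [hij, EuclideanSpace.inner_single_left]
      rw [h1, h2, h3]
      simp only [X, if_neg hij, φ]
      ring
  have hXint : ∀ i j, Integrable (fun θ : Metric.sphere (0 : Euc n) 1 => X i j θ)
      (sphereMeasure n) := by
    intro i j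
    have hc := fun i => (hcoord i).continuous
    have h1 := fun i => (hφ i).continuous
    have h2 := fun i j => (hφ₂ i j).continuous
    have hXc : Continuous (X i j) := by
      simp only [X]
      split_ifs <;> fun_prop
    exact integrable_sphere_of_continuous hXc
  have hsum : ∫ θ, ∑ i, ∑ j, X i j (θ : Euc n) ∂sphereMeasure n = 0 := by
    rw [integral_finsetSum _ fun i _ => integrable_finsetSum _ fun j _ => hXint i j]
    refine Finset.sum_eq_zero fun i _ => ?_
    rw [integral_finsetSum _ fun j _ => hXint i j]
    exact Finset.sum_eq_zero fun j _ => hX i j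
  have hpoint : ∀ θ : Metric.sphere (0 : Euc n) 1, ∑ i, ∑ j, X i j (θ : Euc n)
      = q.1 * lap f (q.2 + q.1 • (θ : Euc n)) - (n - 1) * (∑ j, (θ : Euc n) j * φ j θ)
        - q.1 * ∑ j, (θ : Euc n) j * ∑ i, (θ : Euc n) i * φ₂ i j θ := by
    intro θ
    set x : Euc n := (θ : Euc n)
    have hx : ∑ i, x i ^ 2 = 1 := by
      have h := EuclideanSpace.real_norm_sq_eq x
      rw [show ‖x‖ = 1 from by simp [x]] at h
      rw [← h]; norm_num
    have e1 : ∑ i, ∑ j, (if i = j then x i * φ j x else 0) = ∑ j, x j * φ j x := by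
      simp
    have e2 : ∑ i : Fin n, ∑ j, x j * φ j x = n * ∑ j, x j * φ j x := by
      simp
    have e3 : ∑ i, ∑ j, x i ^ 2 * φ₂ j j x = lap f (q.2 + q.1 • x) := by
      simp only [← Finset.mul_sum, ← Finset.sum_mul, hx, one_mul]
      rfl
    have e4 : ∑ i, ∑ j, x i * x j * φ₂ i j x = ∑ j, x j * ∑ i, x i * φ₂ i j x := by
      rw [Finset.sum_comm]
      refine Finset.sum_congr rfl fun j _ => ?_
      rw [Finset.mul_sum]
      exact Finset.sum_congr rfl fun i _ => by ring
    simp only [X, Finset.sum_add_distrib, Finset.sum_sub_distrib, ← Finset.mul_sum] at *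
    rw [e1, e2, e3, e4]
    ring
  have hr1 : dirDeriv (radial n) (sphAvg f) q
      = ∫ θ, ∑ j, (θ : Euc n) j * φ j θ ∂sphereMeasure n := by
    rw [dirDeriv_radial_sphAvg hf]
  have hr2 : dirDeriv (radial n) (dirDeriv (radial n) (sphAvg f)) q
      = ∫ θ, ∑ j, (θ : Euc n) j * ∑ i, (θ : Euc n) i * φ₂ i j θ ∂sphereMeasure n := by
    rw [dirDeriv_radial_sphAvg hf, dirDeriv_radial_integral hfi hcoord]
    congr 1
    funext θ
    refine Finset.sum_congr rfl fun j _ => ?_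
    rw [dirDeriv_eq_sum (θ : Euc n)]
  have hc := fun i => (hcoord i).continuous
  have h1 := fun i => (hφ i).continuous
  have h2 := fun i j => (hφ₂ i j).continuous
  have h3 : Continuous (fun x : Euc n => lap f (q.2 + q.1 • x)) :=
    (contDiff_lap hf).continuous.comp (by fun_prop)
  have i1 := integrable_sphere_of_continuous h3
  have i2 : Integrable (fun θ : Metric.sphere (0 : Euc n) 1 => ∑ j, (θ : Euc n) j * φ j θ)
    (sphereMeasure n) := integrable_sphere_of_continuous (g := fun x => ∑ j, x j * φ j x) (by fun_prop)
  have i3 : Integrable (fun θ : Metric.sphere (0 : Euc n) 1 =>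
      ∑ j, (θ : Euc n) j * ∑ i, (θ : Euc n) i * φ₂ i j θ) (sphereMeasure n) :=
    integrable_sphere_of_continuous (g := fun x => ∑ j, x j * ∑ i, x i * φ₂ i j x) (by fun_prop)
  simp only [hpoint] at hsum
  have i4 : Integrable (fun θ : Metric.sphere (0 : Euc n) 1 => q.1 * lap f (q.2 + q.1 • (θ : Euc n))
      - (n - 1) * ∑ j, (θ : Euc n) j * φ j θ) (sphereMeasure n) :=
    (i1.const_mul _).sub (i2.const_mul _)
  rw [integral_sub i4 (i3.const_mul _),
    integral_sub (i1.const_mul _) (i2.const_mul _), integral_const_mul, integral_const_mul,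
    integral_const_mul] at hsum
  rw [hr1, hr2, sphAvg]
  linarith

section

/-! ### Euler–Poisson–Darboux equations -/

/-- The Laplacian in the space variable of a function on `ℝ × Eⁿ`. -/
def spaceLap {n : ℕ} (G : ℝ × Euc n → ℝ) (q : ℝ × Euc n) : ℝ :=
  ∑ i, dirDeriv ((0 : ℝ), unitVec i) (dirDeriv ((0 : ℝ), unitVec i) G) q

/-- The Euler–Poisson–Darboux equation `r N_rr + a N_r = r Δ N`. -/
def IsEPD {n : ℕ} (a : ℝ) (N : ℝ × Euc n → ℝ) : Prop :=
  ∀ q, q.1 * dirDeriv (radial n) (dirDeriv (radial n) N) q + a * dirDeriv (radial n) N q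
    = q.1 * spaceLap N q

/-- The operator `b + (r/2) ∂/∂r`; with `σ = r²` it takes the coefficient `N` of `σᵇ N` to that of
`σ^(b-1)` in the derivative with respect to `σ`. -/
def raise {n : ℕ} (b : ℝ) (G : ℝ × Euc n → ℝ) (q : ℝ × Euc n) : ℝ :=
  b * G q + q.1 / 2 * dirDeriv (radial n) G q

variable {n : ℕ}

theorem contDiff_spaceLap {G : ℝ × Euc n → ℝ} (hG : ContDiff ℝ ∞ G) :
    ContDiff ℝ ∞ (spaceLap G) :=
  ContDiff.sum fun _ _ => contDiff_dirDeriv (contDiff_dirDeriv hG _) _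

theorem contDiff_raise (b : ℝ) {G : ℝ × Euc n → ℝ} (hG : ContDiff ℝ ∞ G) :
    ContDiff ℝ ∞ (raise b G) :=
  (contDiff_const.mul hG).add ((contDiff_fst.div_const 2).mul (contDiff_dirDeriv hG _))

theorem dirDeriv_raise_aux (b : ℝ) {G : ℝ × Euc n → ℝ} (hG : ContDiff ℝ ∞ G) (v q : ℝ × Euc n) :
    dirDeriv v (raise b G) q = b * dirDeriv v G q + (v.1 / 2 * dirDeriv (radial n) G q
      + q.1 / 2 * dirDeriv (radial n) (dirDeriv v G) q) := by
  have hγ : HasDerivAt (fun s : ℝ => q + s • v) v 0 :=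
    (((hasDerivAt_id (0 : ℝ)).smul_const v).const_add q).congr_deriv (by simp)
  have hγ1 : HasDerivAt (fun s : ℝ => (q.1 + s * v.1) / 2) (v.1 / 2) 0 :=
    ((((hasDerivAt_id (0 : ℝ)).mul_const v.1).const_add q.1).div_const 2).congr_deriv (by simp)
  have h := (hasDerivAt_line (contDiff_raise b hG) hγ).unique
    (((hasDerivAt_line hG hγ).const_mul b).add
      (hγ1.mul (hasDerivAt_line (contDiff_dirDeriv hG (radial n)) hγ)))
  simp only [zero_smul, add_zero, zero_mul] at h
  rw [h, dirDeriv_comm hG (radial n) v]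

theorem dirDeriv_radial_raise (b : ℝ) {G : ℝ × Euc n → ℝ} (hG : ContDiff ℝ ∞ G) :
    dirDeriv (radial n) (raise b G) = raise (b + 1 / 2) (dirDeriv (radial n) G) := by
  funext q
  rw [dirDeriv_raise_aux b hG, raise]
  ring

theorem dirDeriv_space_raise (b : ℝ) {G : ℝ × Euc n → ℝ} (hG : ContDiff ℝ ∞ G) (v : Euc n) :
    dirDeriv ((0 : ℝ), v) (raise b G) = raise b (dirDeriv ((0 : ℝ), v) G) := by
  funext q
  rw [dirDeriv_raise_aux b hG, raise]
  ring

theorem dirDeriv_sum {V ι : Type} [NormedAddCommGroup V] [NormedSpace ℝ V] (s : Finset ι)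
    {G : ι → V → ℝ} (hG : ∀ i, ContDiff ℝ ∞ (G i)) (v q : V) :
    dirDeriv v (fun q => ∑ i ∈ s, G i q) q = ∑ i ∈ s, dirDeriv v (G i) q := by
  simp only [dirDeriv]
  rw [fderiv_fun_sum fun i _ => (hG i).differentiable (by simp) q]
  simp

theorem spaceLap_raise (b : ℝ) {G : ℝ × Euc n → ℝ} (hG : ContDiff ℝ ∞ G) :
    spaceLap (raise b G) = raise b (spaceLap G) := by
  funext q
  simp only [spaceLap, raise]
  have h := fun i : Fin n => contDiff_dirDeriv hG ((0 : ℝ), unitVec i)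
  change _ = _ + _ * dirDeriv _ (fun q => ∑ i, dirDeriv ((0 : ℝ), unitVec i)
    (dirDeriv ((0 : ℝ), unitVec i) G) q) q
  rw [dirDeriv_sum _ fun i => contDiff_dirDeriv (h i) _, Finset.mul_sum, Finset.mul_sum,
    ← Finset.sum_add_distrib]
  refine Finset.sum_congr rfl fun i _ => ?_
  rw [dirDeriv_space_raise b hG, dirDeriv_space_raise b (h i)]
  rfl

/-- This is one derivative in `σ = r²` of `σ^((a-1)/2) N`. Since `∂_r` carries `raise b` to `raise
(b + 1/2)` and the Laplacian commutes with it, the new equation is `r/2` times the `r`-derivative of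
the old one plus `(a-2)/2` times the old one. -/
theorem IsEPD.raise {a : ℝ} {N : ℝ × Euc n → ℝ} (hN : ContDiff ℝ ∞ N) (h : IsEPD a N) :
    IsEPD (a - 2) (raise ((a - 1) / 2) N) := by
  intro q
  have h1 := contDiff_dirDeriv hN (radial n)
  have h2 := contDiff_dirDeriv h1 (radial n)
  have hL := contDiff_spaceLap hN
  have hγ : HasDerivAt (fun s : ℝ => q + s • radial n) (radial n) 0 :=
    (((hasDerivAt_id (0 : ℝ)).smul_const (radial n)).const_add q).congr_deriv (by simp)
  have hγ1 : HasDerivAt (fun s : ℝ => q.1 + s) 1 0 := (hasDerivAt_id (0 : ℝ)).const_add q.1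
  have hl := (hγ1.mul (hasDerivAt_line h2 hγ)).add ((hasDerivAt_line h1 hγ).const_mul a)
  have hr := hγ1.mul (hasDerivAt_line hL hγ)
  have hfun : ((fun s : ℝ => q.1 + s) * fun s : ℝ =>
      dirDeriv (radial n) (dirDeriv (radial n) N) (q + s • radial n))
      + (fun s : ℝ => a * dirDeriv (radial n) N (q + s • radial n))
      = (fun s : ℝ => q.1 + s) * fun s : ℝ => spaceLap N (q + s • radial n) := by
    funext s
    simpa using h (q + s • radial n)
  have hl' := hl.congr_deriv rfl
  rw [hfun] at hl'
  have key := hl'.unique hr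
  simp only [zero_smul, add_zero, one_mul] at key
  have h0 := h q
  rw [spaceLap_raise _ hN, dirDeriv_radial_raise _ hN, dirDeriv_radial_raise _ h1]
  simp only [TimeReversal.raise]
  linear_combination q.1 / 2 * key + (a - 2) / 2 * h0

theorem spaceLap_sphAvg {f : Euc n → ℝ} (hf : ContDiff ℝ ∞ f) :
    spaceLap (sphAvg f) = sphAvg (lap f) := by
  funext q
  simp only [spaceLap, sphAvg, lap]
  rw [integral_finsetSum]
  · refine Finset.sum_congr rfl fun i _ => ?_
    rw [dirDeriv_sphAvg_space hf, dirDeriv_sphAvg_space (contDiff_dirDeriv hf _), sphAvg]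
  · intro i _
    have h := (contDiff_dirDeriv (contDiff_dirDeriv hf (unitVec i)) (unitVec i)).continuous
    exact integrable_sphere_of_continuous (g := fun x => dirDeriv (unitVec i)
      (dirDeriv (unitVec i) f) (q.2 + q.1 • x)) (h.comp (by fun_prop))

/-- The coefficients `S_j` of `∂_σ^j (σ^((n-2)/2) M(√σ)) = σ^((n-2)/2-j) S_j(√σ)`, where `M` is
the spherical mean of `f`. -/
def raisedAvg (f : Euc n → ℝ) : ℕ → ℝ × Euc n → ℝ
  | 0 => sphAvg f
  | j + 1 => raise ((n - 2 - 2 * j) / 2) (raisedAvg f j)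

theorem contDiff_raisedAvg {f : Euc n → ℝ} (hf : ContDiff ℝ ∞ f) (j : ℕ) :
    ContDiff ℝ ∞ (raisedAvg f j) := by
  induction j with
  | zero => exact contDiff_sphAvg hf
  | succ j ih => exact contDiff_raise _ ih

theorem isEPD_raisedAvg {f : Euc n → ℝ} (hf : ContDiff ℝ ∞ f) (j : ℕ) :
    IsEPD (n - 1 - 2 * j) (raisedAvg f j) := by
  induction j with
  | zero =>
    intro q
    have := darboux hf q
    rw [← spaceLap_sphAvg hf] at this
    simpa [raisedAvg] using this
  | succ j ih =>
    have h := ih.raise (contDiff_raisedAvg hf j)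
    rw [raisedAvg]
    convert h using 1
    · push_cast; ring
    · congr 1; ring

/-- At `r = 0` the term `(r/2) ∂_r` of each `raise` drops out and only the constants multiply. -/
theorem raisedAvg_zero_left (f : Euc n → ℝ) (j : ℕ) (y : Euc n) :
    raisedAvg f j (0, y) = (∏ i ∈ Finset.range j, ((n : ℝ) - 2 - 2 * i) / 2)
      * ((sphereMeasure n).real univ * f y) := by
  induction j with
  | zero => simp [raisedAvg, sphAvg]
  | succ j ih =>
    rw [raisedAvg, raise, ih, Finset.prod_range_succ]
    simp
    ring

/-- A regular solution `V` of the Euler–Poisson–Darboux equation with `a = 2` gives the solution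
`t V(t, y)` of the wave equation. -/
theorem isCauchySolution_of_isEPD {f : Euc n → ℝ} {u : ℝ → Euc n → ℝ} {V : ℝ × Euc n → ℝ}
    (hV : ContDiff ℝ ∞ V) (hE : IsEPD 2 V) (h0 : ∀ y, V (0, y) = f y)
    (hu : ∀ t > 0, ∀ y, u t y = t * V (t, y)) : IsCauchySolution f u := by
  have hline : ∀ (y : Euc n) (t : ℝ), HasDerivAt (fun s : ℝ => (s, y)) (radial n) t := fun y t =>
    (hasDerivAt_id t).prodMk (hasDerivAt_const t y)
  have hV1 := contDiff_dirDeriv hV (radial n)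
  have hd : ∀ (y : Euc n) (t : ℝ), 0 < t →
      HasDerivAt (fun s => u s y) (V (t, y) + t * dirDeriv (radial n) V (t, y)) t := by
    intro y t ht
    have h := (hasDerivAt_id t).mul (hasDerivAt_line hV (hline y t))
    refine (h.congr_deriv (by simp)).congr_of_eventuallyEq ?_
    filter_upwards [lt_mem_nhds ht] with s hs
    simp [hu s hs]
  refine ⟨?_, ?_, ?_, ?_⟩
  · have h : ContDiff ℝ 2 (fun q : ℝ × Euc n => q.1 * V q) :=
      contDiff_infty.1 (contDiff_fst.mul hV) 2
    exact h.contDiffOn.congr fun q hq => hu q.1 hq.1 q.2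
  · intro t ht y
    have hder : deriv (fun s => u s y) =ᶠ[𝓝 t]
        fun s => V (s, y) + s * dirDeriv (radial n) V (s, y) := by
      filter_upwards [lt_mem_nhds ht] with s hs using (hd y s hs).deriv
    have h2 := (hasDerivAt_line hV (hline y t)).add
      ((hasDerivAt_id t).mul (hasDerivAt_line hV1 (hline y t)))
    have hl : iteratedDeriv 2 (fun s => u s y) t = 2 * dirDeriv (radial n) V (t, y)
        + t * dirDeriv (radial n) (dirDeriv (radial n) V) (t, y) := by
      rw [iteratedDeriv_succ, iteratedDeriv_one, hder.deriv_eq]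
      refine (h2.congr_deriv ?_).deriv
      simp
      ring
    have hut : u t = fun y => t * V (t, y) := funext (hu t ht)
    have hVt : ContDiff ℝ ∞ (fun y => V (t, y)) := hV.comp (contDiff_prodMk_right t)
    have hsl : ∀ (G : ℝ × Euc n → ℝ), ContDiff ℝ ∞ G → ∀ v : Euc n,
        dirDeriv v (fun y => G (t, y)) = fun y => dirDeriv ((0 : ℝ), v) G (t, y) := by
      intro G hG v
      funext y
      have := dirDeriv_comp_add ((0 : ℝ), v) (ContinuousLinearMap.inr ℝ ℝ (Euc n)) v (t, 0)
        (by simp) hG y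
      simpa using this
    rw [hl, hut, laplacian_eq_sum_dirDeriv (contDiff_const.mul hVt)]
    have hsum : ∀ i : Fin n, dirDeriv (unitVec i) (dirDeriv (unitVec i) fun y => t * V (t, y)) y
        = t * dirDeriv ((0 : ℝ), unitVec i) (dirDeriv ((0 : ℝ), unitVec i) V) (t, y) := by
      intro i
      have h1 := contDiff_dirDeriv hV ((0 : ℝ), unitVec i)
      rw [dirDeriv_const_mul _ _ hVt, hsl V hV,
        dirDeriv_const_mul (unitVec i) t (G := fun y => dirDeriv ((0 : ℝ), unitVec i) V (t, y))
          (h1.comp (contDiff_prodMk_right t)), hsl _ h1]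
    rw [Finset.sum_congr rfl fun i _ => hsum i, ← Finset.mul_sum]
    -- `(tV)_tt = 2 V_t + t V_tt` is the left side of the equation with `a = 2`.
    have := hE (t, y)
    simp only [spaceLap] at this
    linarith
  · intro y
    have h : Tendsto (fun q : ℝ × Euc n => q.1 * V q) (𝓝[Ioi 0 ×ˢ univ] (0, y)) (𝓝 0) := by
      have := (continuous_fst.mul hV.continuous).tendsto ((0 : ℝ), y)
      simp only [Pi.mul_apply, zero_mul] at this
      exact this.mono_left nhdsWithin_le_nhds
    exact h.congr' (eventually_nhdsWithin_of_forall fun q hq => (hu q.1 hq.1 q.2).symm)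
  · intro y
    have h : Tendsto (fun q : ℝ × Euc n => V q + q.1 * dirDeriv (radial n) V q)
        (𝓝[Ioi 0 ×ˢ univ] (0, y)) (𝓝 (f y)) := by
      have := (hV.continuous.add (continuous_fst.mul hV1.continuous)).tendsto ((0 : ℝ), y)
      simp only [Pi.add_apply, Pi.mul_apply, zero_mul, add_zero, h0] at this
      exact this.mono_left nhdsWithin_le_nhds
    exact h.congr' (eventually_nhdsWithin_of_forall fun q hq => (hd q.2 q.1 hq.1).deriv.symm)

/-! ### Descent from the equation with `a = 1` -/

/-- The measure `dα` on `[0, π/2]`. -/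
abbrev angleMeasure : Measure (Icc (0 : ℝ) (Real.pi / 2)) :=
  Measure.comap Subtype.val volume

/-- The average `∫₀^{π/2} S(t sin α, y) sin α dα`. -/
def descent (S : ℝ × Euc n → ℝ) (q : ℝ × Euc n) : ℝ :=
  ∫ α : Icc (0 : ℝ) (Real.pi / 2), S (q.1 * Real.sin α, q.2) * Real.sin α ∂angleMeasure

instance : IsFiniteMeasure angleMeasure :=
  ⟨by
    rw [(MeasurableEmbedding.subtype_coe measurableSet_Icc).comap_apply, image_univ,
      Subtype.range_coe]
    exact measure_Icc_lt_top⟩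

theorem integral_angleMeasure (g : ℝ → ℝ) :
    ∫ α : Icc (0 : ℝ) (Real.pi / 2), g α ∂angleMeasure = ∫ α in (0 : ℝ)..(Real.pi / 2), g α := by
  rw [integral_subtype_comap measurableSet_Icc, integral_Icc_eq_integral_Ioc,
    intervalIntegral.integral_of_le (by positivity)]

theorem contDiff_weighted_integrand {S : ℝ × Euc n → ℝ} (hS : ContDiff ℝ ∞ S) (m : ℕ) :
    ContDiff ℝ ∞ (fun z : (ℝ × Euc n) × ℝ =>
      S (z.1.1 * Real.sin z.2, z.1.2) * Real.sin z.2 ^ m) := by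
  have h : ContDiff ℝ ∞ (fun z : (ℝ × Euc n) × ℝ => Real.sin z.2) :=
    Real.contDiff_sin.comp contDiff_snd
  exact (hS.comp (((contDiff_fst.comp contDiff_fst).mul h).prodMk
    (contDiff_snd.comp contDiff_fst))).mul (h.pow m)

/-- The exponent is general because each radial derivative releases one more factor `sin α`. -/
theorem dirDeriv_weighted {S : ℝ × Euc n → ℝ} (hS : ContDiff ℝ ∞ S) (m : ℕ) (v : ℝ × Euc n) :
    dirDeriv v (fun q => ∫ α : Icc (0 : ℝ) (Real.pi / 2),
      S (q.1 * Real.sin α, q.2) * Real.sin α ^ m ∂angleMeasure)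
    = fun q => ∫ α : Icc (0 : ℝ) (Real.pi / 2),
      dirDeriv (v.1 * Real.sin α, v.2) S (q.1 * Real.sin α, q.2) * Real.sin α ^ m
        ∂angleMeasure := by
  funext q
  refine (dirDeriv_integral angleMeasure continuous_subtype_val
    (contDiff_weighted_integrand hS m) v q).trans
    (integral_congr_ae (Eventually.of_forall fun α => ?_))
  have hγ : HasDerivAt (fun s : ℝ => (q + s • v, (α : ℝ))) (v, (0 : ℝ)) 0 := by
    refine HasDerivAt.prodMk ?_ (hasDerivAt_const _ _)
    exact (((hasDerivAt_id (0 : ℝ)).smul_const v).const_add q).congr_deriv (by simp)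
  have hγ' : HasDerivAt (fun s : ℝ => ((q.1 + s * v.1) * Real.sin α, q.2 + s • v.2))
      (v.1 * Real.sin α, v.2) 0 := by
    refine HasDerivAt.prodMk ?_ ?_
    · exact ((((hasDerivAt_id (0 : ℝ)).mul_const v.1).const_add q.1).mul_const _).congr_deriv
        (by simp)
    · exact (((hasDerivAt_id (0 : ℝ)).smul_const v.2).const_add q.2).congr_deriv (by simp)
  have h := (hasDerivAt_line (contDiff_weighted_integrand hS m) hγ).unique
    ((hasDerivAt_line hS hγ').mul_const (Real.sin α ^ m))
  simpa using h

theorem contDiff_descent {S : ℝ × Euc n → ℝ} (hS : ContDiff ℝ ∞ S) : ContDiff ℝ ∞ (descent S) := by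
  have := contDiff_integral angleMeasure continuous_subtype_val (contDiff_weighted_integrand hS 1)
  simp only [pow_one] at this
  exact this

/-- By the equation for `S` with `a = 1`, the defect of the equation with `a = 2` has as integrand
the `α`-derivative of `-cos α sin α S_r(r sin α, y)`, which vanishes at both ends of `[0, π/2]`. -/
theorem isEPD_descent {S : ℝ × Euc n → ℝ} (hS : ContDiff ℝ ∞ S) (h : IsEPD 1 S) :
    IsEPD 2 (descent S) := by
  intro q
  have hS1 := contDiff_dirDeriv hS (radial n)
  have hS2 := contDiff_dirDeriv hS1 (radial n)
  have hdes : descent S = fun q => ∫ α : Icc (0 : ℝ) (Real.pi / 2),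
      S (q.1 * Real.sin α, q.2) * Real.sin α ^ 1 ∂angleMeasure := by
    funext q; simp only [descent, pow_one]
  have hrad : ∀ (G : ℝ × Euc n → ℝ) (m : ℕ), ContDiff ℝ ∞ G →
      dirDeriv (radial n) (fun q => ∫ α : Icc (0 : ℝ) (Real.pi / 2),
        G (q.1 * Real.sin α, q.2) * Real.sin α ^ m ∂angleMeasure)
      = fun q => ∫ α : Icc (0 : ℝ) (Real.pi / 2),
        dirDeriv (radial n) G (q.1 * Real.sin α, q.2) * Real.sin α ^ (m + 1) ∂angleMeasure := by
    intro G m hG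
    rw [dirDeriv_weighted hG]
    funext q
    congr 1
    funext α
    have : ((1 : ℝ) * Real.sin α, (0 : Euc n)) = Real.sin α • radial n := by simp
    simp only [dirDeriv]
    rw [this, map_smul, smul_eq_mul]
    ring
  have hsp : ∀ (G : ℝ × Euc n → ℝ) (m : ℕ) (v : Euc n), ContDiff ℝ ∞ G →
      dirDeriv ((0 : ℝ), v) (fun q => ∫ α : Icc (0 : ℝ) (Real.pi / 2),
        G (q.1 * Real.sin α, q.2) * Real.sin α ^ m ∂angleMeasure)
      = fun q => ∫ α : Icc (0 : ℝ) (Real.pi / 2),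
        dirDeriv ((0 : ℝ), v) G (q.1 * Real.sin α, q.2) * Real.sin α ^ m ∂angleMeasure := by
    intro G m v hG
    rw [dirDeriv_weighted hG]
    simp only [zero_mul]
  have hint : ∀ (G : ℝ × Euc n → ℝ) (m : ℕ), ContDiff ℝ ∞ G → Integrable
      (fun α : Icc (0 : ℝ) (Real.pi / 2) => G (q.1 * Real.sin α, q.2) * Real.sin α ^ m)
      angleMeasure := by
    intro G m hG
    have hc : Continuous (fun α : ℝ => G (q.1 * Real.sin α, q.2) * Real.sin α ^ m) := by
      have := hG.continuous
      fun_prop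
    exact (hc.comp continuous_subtype_val).integrable_of_hasCompactSupport
      (HasCompactSupport.of_compactSpace _)
  have hlap : spaceLap (descent S) q = ∫ α : Icc (0 : ℝ) (Real.pi / 2),
      spaceLap S (q.1 * Real.sin α, q.2) * Real.sin α ^ 1 ∂angleMeasure := by
    simp only [spaceLap, Finset.sum_mul]
    rw [integral_finsetSum _ fun i _ => hint _ 1 (contDiff_dirDeriv (contDiff_dirDeriv hS _) _)]
    refine Finset.sum_congr rfl fun i _ => ?_
    rw [hdes, hsp _ _ _ hS, hsp _ _ _ (contDiff_dirDeriv hS _)]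
  rw [hlap, hdes, hrad _ _ hS, hrad _ _ hS1]
  simp only [Nat.reduceAdd]
  have hadd : Integrable (fun α : Icc (0 : ℝ) (Real.pi / 2) =>
      q.1 * (dirDeriv (radial n) (dirDeriv (radial n) S) (q.1 * Real.sin α, q.2) * Real.sin α ^ 3)
        + 2 * (dirDeriv (radial n) S (q.1 * Real.sin α, q.2) * Real.sin α ^ 2)) angleMeasure :=
    ((hint _ 3 hS2).const_mul _).add ((hint _ 2 hS1).const_mul _)
  rw [← integral_const_mul, ← integral_const_mul, ← integral_const_mul, ← integral_add
    ((hint _ _ hS2).const_mul _) ((hint _ _ hS1).const_mul _), ← sub_eq_zero, ← integral_sub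
    hadd ((hint _ _ (contDiff_spaceLap hS)).const_mul _)]
  have hprim : ∀ α : ℝ, HasDerivAt (fun α => -(Real.cos α * Real.sin α
      * dirDeriv (radial n) S (q.1 * Real.sin α, q.2)))
      (q.1 * (dirDeriv (radial n) (dirDeriv (radial n) S) (q.1 * Real.sin α, q.2) * Real.sin α ^ 3)
        + 2 * (dirDeriv (radial n) S (q.1 * Real.sin α, q.2) * Real.sin α ^ 2)
        - q.1 * (spaceLap S (q.1 * Real.sin α, q.2) * Real.sin α ^ 1)) α := by
    intro α
    have hγ : HasDerivAt (fun α : ℝ => (q.1 * Real.sin α, q.2))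
        ((q.1 * Real.cos α) • radial n) α := by
      exact (((Real.hasDerivAt_sin α).const_mul q.1).prodMk (hasDerivAt_const α q.2)).congr_deriv
        (by simp)
    have hd := (((Real.hasDerivAt_cos α).mul (Real.hasDerivAt_sin α)).mul
      (hasDerivAt_line hS1 hγ)).neg
    refine hd.congr_deriv ?_
    have hh := h (q.1 * Real.sin α, q.2)
    simp only [one_mul] at hh
    have hsm : dirDeriv ((q.1 * Real.cos α) • radial n) (dirDeriv (radial n) S)
        (q.1 * Real.sin α, q.2) = q.1 * Real.cos α * dirDeriv (radial n) (dirDeriv (radial n) S)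
        (q.1 * Real.sin α, q.2) := by
      conv_lhs => rw [dirDeriv, map_smul, smul_eq_mul]
      rfl
    rw [hsm]
    have hc2 : Real.cos α ^ 2 = 1 - Real.sin α ^ 2 := by
      linarith [Real.sin_sq_add_cos_sq α]
    simp only [Pi.mul_apply]
    linear_combination -hh - (q.1 * Real.sin α * dirDeriv (radial n) (dirDeriv (radial n) S)
        (q.1 * Real.sin α, q.2) + dirDeriv (radial n) S (q.1 * Real.sin α, q.2)) * hc2
  have hcont : Continuous fun α : ℝ => q.1 * (dirDeriv (radial n) (dirDeriv (radial n) S)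
      (q.1 * Real.sin α, q.2) * Real.sin α ^ 3)
        + 2 * (dirDeriv (radial n) S (q.1 * Real.sin α, q.2) * Real.sin α ^ 2)
        - q.1 * (spaceLap S (q.1 * Real.sin α, q.2) * Real.sin α ^ 1) := by
    have h1 := hS1.continuous
    have h2 := hS2.continuous
    have h3 := (contDiff_spaceLap hS).continuous
    fun_prop
  refine (integral_angleMeasure (fun α => q.1 * (dirDeriv (radial n) (dirDeriv (radial n) S)
      (q.1 * Real.sin α, q.2) * Real.sin α ^ 3)
        + 2 * (dirDeriv (radial n) S (q.1 * Real.sin α, q.2) * Real.sin α ^ 2)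
        - q.1 * (spaceLap S (q.1 * Real.sin α, q.2) * Real.sin α ^ 1))).trans ?_
  rw [intervalIntegral.integral_eq_sub_of_hasDerivAt (fun α _ => hprim α)
    (hcont.intervalIntegrable _ _)]
  simp

theorem descent_zero_left (S : ℝ × Euc n → ℝ) (y : Euc n) : descent S (0, y) = S (0, y) := by
  simp only [descent, zero_mul]
  rw [integral_const_mul, integral_angleMeasure Real.sin]
  simp

theorem IsEPD.const_mul {a : ℝ} {N : ℝ × Euc n → ℝ} (hN : ContDiff ℝ ∞ N) (h : IsEPD a N) (c : ℝ) :
    IsEPD a (fun q => c * N q) := by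
  intro q
  have h1 := fun v => contDiff_dirDeriv hN v
  simp only [spaceLap, dirDeriv_const_mul _ c hN, dirDeriv_const_mul _ c (h1 _), ← Finset.mul_sum]
  have := h q
  simp only [spaceLap] at this
  linear_combination c * this

end

section

/-! ### The transmitted signal solves the Cauchy problem -/

variable {n : ℕ}

/-- The sphere has area `2 π^(n/2) / Γ(n/2)`, and the product is `Γ(n/2) / Γ(x)` by the functional
equation. It serves for `x = 1` (even `n`) and `x = 3/2` (odd `n`), to normalise the initial
velocity. -/
theorem prod_half_mul_sphereMeasure (hn : 2 ≤ n) (k : ℕ) (x : ℝ) (hx : 0 < x)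
    (hxk : (n : ℝ) / 2 = x + k) :
    (∏ i ∈ Finset.range k, ((n : ℝ) - 2 - 2 * i) / 2) * (sphereMeasure n).real univ
      = 2 * √Real.pi ^ n / Real.Gamma x := by
  have hG : ∀ (k : ℕ), Real.Gamma (x + k) = (∏ i ∈ Finset.range k, (x + k - 1 - i)) * Real.Gamma x := by
    intro k
    induction k with
    | zero => simp
    | succ k ih =>
      rw [Finset.prod_range_succ']
      have h1 : ∀ i : ℕ, x + ((k + 1 : ℕ) : ℝ) - 1 - ((i + 1 : ℕ) : ℝ) = x + k - 1 - i := by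
        intro i; push_cast; ring
      simp only [h1]
      rw [show x + ((k + 1 : ℕ) : ℝ) = x + k + 1 by push_cast; ring, Real.Gamma_add_one (by positivity),
        ih]
      push_cast
      ring
  have hprod : (∏ i ∈ Finset.range k, ((n : ℝ) - 2 - 2 * i) / 2)
      = ∏ i ∈ Finset.range k, (x + k - 1 - i) :=
    Finset.prod_congr rfl fun i _ => by linear_combination hxk
  have hn0 : (0 : ℝ) < n := by exact_mod_cast (by omega : 0 < n)
  have : Nonempty (Fin n) := ⟨⟨0, by omega⟩⟩
  have hΓ : 0 < Real.Gamma ((n : ℝ) / 2) := Real.Gamma_pos_of_pos (by positivity)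
  have hS : (sphereMeasure n).real univ = 2 * √Real.pi ^ n / Real.Gamma ((n : ℝ) / 2) := by
    rw [Measure.toSphere_real_apply_univ, measureReal_def, EuclideanSpace.volume_ball]
    simp only [finrank_euclideanSpace, Fintype.card_fin]
    rw [Real.Gamma_add_one (by positivity), ENNReal.ofReal_one, one_pow, one_mul,
      ENNReal.toReal_ofReal (by positivity)]
    field_simp
  have hΓx : 0 < Real.Gamma x := Real.Gamma_pos_of_pos hx
  rw [hS, hprod, hxk]
  rw [hxk] at hΓ
  rw [hG k] at hΓ ⊢
  have hP := (pos_of_mul_pos_left hΓ hΓx.le).ne'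
  field_simp

theorem sphericalMean_eq (f : Euc n → ℝ) (r : ℝ) (y : Euc n) :
    sphericalMean f r y = r ^ (n - 1) * sphAvg f (r, y) := rfl

theorem hasDerivAt_radialSlice {G : ℝ × Euc n → ℝ} (hG : ContDiff ℝ ∞ G) (r : ℝ) (y : Euc n) :
    HasDerivAt (fun r => G (r, y)) (dirDeriv (radial n) G (r, y)) r :=
  hasDerivAt_line hG ((hasDerivAt_id r).prodMk (hasDerivAt_const r y))

/-- With `σ = t² - s` the density is `σ^((n-2)/2) M(√σ) / 2`, and `d/ds = -d/dσ` accounts for the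
sign. The bound on `j` keeps the natural-number exponent from being truncated. -/
theorem iteratedDeriv_sphericalMean_of_lt {f : Euc n → ℝ} (hf : ContDiff ℝ ∞ f) (t : ℝ) (y : Euc n)
    (j : ℕ) (hj : 2 * j + 2 ≤ n) : ∀ s < t ^ 2,
    iteratedDeriv j (fun s => sphericalMean f √(t ^ 2 - s) y / (2 * √(t ^ 2 - s))) s
      = (-1) ^ j / 2 * (√(t ^ 2 - s) ^ (n - 2 - 2 * j) * raisedAvg f j (√(t ^ 2 - s), y)) := by
  induction j with
  | zero =>
    intro s hs
    have hr : 0 < √(t ^ 2 - s) := Real.sqrt_pos.2 (by linarith)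
    rw [iteratedDeriv_zero, sphericalMean_eq, raisedAvg,
      show n - 1 = n - 2 - 2 * 0 + 1 by omega, pow_succ]
    field_simp
  | succ j ih =>
    intro s hs
    have hr : 0 < √(t ^ 2 - s) := Real.sqrt_pos.2 (by linarith)
    have hr2 : HasDerivAt (fun s => √(t ^ 2 - s)) (-1 / (2 * √(t ^ 2 - s))) s :=
      ((hasDerivAt_id s).const_sub (t ^ 2)).sqrt (by simp; linarith)
    rw [iteratedDeriv_succ]
    have hev : iteratedDeriv j (fun s => sphericalMean f √(t ^ 2 - s) y / (2 * √(t ^ 2 - s)))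
        =ᶠ[𝓝 s] fun s => (-1) ^ j / 2 *
          (√(t ^ 2 - s) ^ (n - 2 - 2 * j) * raisedAvg f j (√(t ^ 2 - s), y)) := by
      filter_upwards [gt_mem_nhds hs] with s' hs' using ih (by omega) s' hs'
    rw [hev.deriv_eq]
    have hd := ((hr2.pow (n - 2 - 2 * j)).mul
      ((hasDerivAt_radialSlice (contDiff_raisedAvg hf j) _ y).comp s hr2)).const_mul ((-1) ^ j / 2)
    refine hd.deriv.trans ?_
    obtain ⟨m, hm⟩ : ∃ m, n - 2 - 2 * j = m + 2 := ⟨n - 2 - 2 * j - 2, by omega⟩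
    have hm' : n - 2 - 2 * (j + 1) = m := by omega
    have hmn : (n : ℝ) = m + 2 + 2 + 2 * j := by
      have : n = m + 2 + 2 + 2 * j := by omega
      exact_mod_cast this
    simp only [hm, hm', raisedAvg, raise, hmn]
    simp only [Pi.pow_apply, Function.comp, show m + 2 - 1 = m + 1 by omega]
    push_cast
    field_simp
    ring

/-- Past `s = t²` the square root is 0 by convention, and division by zero makes the density vanish
there, as it should. -/
theorem iteratedDeriv_sphericalMean_of_gt (f : Euc n → ℝ) (t : ℝ) (y : Euc n) (j : ℕ) (s : ℝ)
    (hs : t ^ 2 < s) :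
    iteratedDeriv j (fun s => sphericalMean f √(t ^ 2 - s) y / (2 * √(t ^ 2 - s))) s = 0 := by
  have hev : (fun s => sphericalMean f √(t ^ 2 - s) y / (2 * √(t ^ 2 - s))) =ᶠ[𝓝 s] fun _ => 0 := by
    filter_upwards [lt_mem_nhds hs] with s' hs'
    simp [Real.sqrt_eq_zero_of_nonpos (show t ^ 2 - s' ≤ 0 by linarith)]
  rw [hev.iteratedDeriv_eq]
  simp

theorem transmit_of_odd {f : Euc n → ℝ} (hf : ContDiff ℝ ∞ f) (hn : 2 ≤ n) (hodd : Odd n) {t : ℝ}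
    (ht : 0 < t) (y : Euc n) : transmit f t y
      = t * (1 / (4 * Real.pi) * (1 / Real.pi) ^ ((n - 2) / 2)
        * raisedAvg f ((n - 2) / 2) (t, y)) := by
  obtain ⟨m, hm⟩ := hodd
  rw [transmit, if_pos ht, propagatorKernel, if_pos ⟨m, hm⟩,
    iteratedDeriv_sphericalMean_of_lt hf t y _ (by omega) 0 (by positivity), sub_zero,
    Real.sqrt_sq ht.le, show n - 2 - 2 * ((n - 2) / 2) = 1 by omega]
  have : (-1 / Real.pi) ^ ((n - 2) / 2) * (-1) ^ ((n - 2) / 2) = (1 / Real.pi) ^ ((n - 2) / 2) := by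
    rw [← mul_pow]
    congr 1
    ring
  rw [← this]
  field_simp
  ring

theorem image_sq_cos {t : ℝ} (ht : 0 < t) :
    (fun α => (t * Real.cos α) ^ 2) '' Ioo 0 (Real.pi / 2) = Ioo 0 (t ^ 2) := by
  ext s
  constructor
  · rintro ⟨α, ⟨h0, h1⟩, rfl⟩
    have hc : 0 < Real.cos α := Real.cos_pos_of_mem_Ioo ⟨by linarith [Real.pi_pos], h1⟩
    have hs : 0 < Real.sin α := Real.sin_pos_of_pos_of_lt_pi h0 (by linarith [Real.pi_pos])
    refine ⟨by positivity, ?_⟩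
    have := Real.sin_sq_add_cos_sq α
    have h2 : 0 < t ^ 2 * Real.sin α ^ 2 := by positivity
    simp only
    nlinarith
  · rintro ⟨h0, h1⟩
    have hst : √s < t := by
      rw [Real.sqrt_lt' ht]; exact h1
    have hs0 : 0 < √s := Real.sqrt_pos.2 h0
    have hlt : √s / t < 1 := by rw [div_lt_one ht]; exact hst
    have hpos : 0 < √s / t := by positivity
    refine ⟨Real.arccos (√s / t), ⟨Real.arccos_pos.2 hlt, Real.arccos_lt_pi_div_two.2 hpos⟩, ?_⟩
    simp only
    rw [Real.cos_arccos (by linarith) hlt.le, mul_div_cancel₀ _ ht.ne', Real.sq_sqrt h0.le]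

/-- Substitution `s = (t cos α)²` in the Abel integral over `(0, t²)`. -/
theorem integral_abel_eq (g : ℝ → ℝ) {t : ℝ} (ht : 0 < t) :
    ∫ s in Ioo 0 (t ^ 2), g √(t ^ 2 - s) / √s
      = 2 * t * ∫ α in (0 : ℝ)..(Real.pi / 2), g (t * Real.sin α) * Real.sin α := by
  have hder : ∀ α ∈ Ioo 0 (Real.pi / 2), HasDerivWithinAt (fun α => (t * Real.cos α) ^ 2)
      (-(2 * t ^ 2 * (Real.cos α * Real.sin α))) (Ioo 0 (Real.pi / 2)) α := by
    intro α _
    refine ((((Real.hasDerivAt_cos α).const_mul t).pow 2).congr_deriv ?_).hasDerivWithinAt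
    simp
    ring
  have hinj : InjOn (fun α => (t * Real.cos α) ^ 2) (Ioo 0 (Real.pi / 2)) := by
    intro α hα β hβ h
    have hcα : 0 < Real.cos α := Real.cos_pos_of_mem_Ioo ⟨by linarith [Real.pi_pos, hα.1], hα.2⟩
    have hcβ : 0 < Real.cos β := Real.cos_pos_of_mem_Ioo ⟨by linarith [Real.pi_pos, hβ.1], hβ.2⟩
    have h2 := (pow_left_inj₀ (by positivity) (by positivity) two_ne_zero).1 h
    exact Real.injOn_cos ⟨hα.1.le, by linarith [Real.pi_pos, hα.2]⟩
      ⟨hβ.1.le, by linarith [Real.pi_pos, hβ.2]⟩ (mul_left_cancel₀ ht.ne' h2)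
  rw [← image_sq_cos ht, integral_image_eq_integral_abs_deriv_smul measurableSet_Ioo hder hinj,
    intervalIntegral.integral_of_le (by positivity), integral_Ioc_eq_integral_Ioo,
    ← integral_const_mul]
  refine setIntegral_congr_fun measurableSet_Ioo fun α hα => ?_
  have hc : 0 < Real.cos α := Real.cos_pos_of_mem_Ioo ⟨by linarith [Real.pi_pos, hα.1], hα.2⟩
  have hs : 0 < Real.sin α :=
    Real.sin_pos_of_pos_of_lt_pi hα.1 (by linarith [Real.pi_pos, hα.2])
  have h1 : t ^ 2 - (t * Real.cos α) ^ 2 = (t * Real.sin α) ^ 2 := by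
    have := Real.sin_sq_add_cos_sq α
    linear_combination -t ^ 2 * this
  simp only [h1, smul_eq_mul]
  rw [Real.sqrt_sq (by positivity), Real.sqrt_sq (by positivity), abs_neg,
    abs_of_pos (by positivity)]
  field_simp

/-- Here the power of the radius left after `k` derivatives is `n - 2 - 2k = 0`; the factor `t`, for
odd `n` that remaining power, now comes from the substitution in `integral_abel_eq`. -/
theorem transmit_of_even {f : Euc n → ℝ} (hf : ContDiff ℝ ∞ f) (hn : 2 ≤ n) (heven : Even n) {t : ℝ}
    (ht : 0 < t) (y : Euc n) : transmit f t y
      = t * (1 / (2 * Real.pi) * (1 / Real.pi) ^ ((n - 2) / 2)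
        * descent (raisedAvg f ((n - 2) / 2)) (t, y)) := by
  have hnodd : ¬ Odd n := Nat.not_odd_iff_even.2 heven
  obtain ⟨m, hm⟩ := heven
  set k := (n - 2) / 2 with hk
  have hint : ∫ s in Ioi (0 : ℝ), iteratedDeriv k
      (fun s => sphericalMean f √(t ^ 2 - s) y / (2 * √(t ^ 2 - s))) s / √s
      = ∫ s in Ioo 0 (t ^ 2), ((-1) ^ k / 2 * raisedAvg f k (√(t ^ 2 - s), y)) / √s := by
    rw [setIntegral_eq_of_subset_of_ae_sdiff_eq_zero measurableSet_Ioi.nullMeasurableSet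
      (fun s (hs : s ∈ Ioo 0 (t ^ 2)) => hs.1)]
    · refine setIntegral_congr_fun measurableSet_Ioo fun s hs => ?_
      rw [iteratedDeriv_sphericalMean_of_lt hf t y k (by omega) s hs.2,
        show n - 2 - 2 * k = 0 by omega, pow_zero, one_mul]
    -- Neither formula for the derivative covers the point `s = t²`, which is null.
    · filter_upwards [Measure.ae_ne volume (t ^ 2)] with s hs hs'
      have : t ^ 2 < s := by
        rcases lt_trichotomy s (t ^ 2) with h | h | h
        · exact absurd ⟨hs'.1, h⟩ hs'.2
        · exact absurd h hs
        · exact h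
      rw [iteratedDeriv_sphericalMean_of_gt f t y k s this, zero_div]
  rw [transmit, if_pos ht, propagatorKernel, if_neg hnodd, hint,
    integral_abel_eq (fun r => (-1) ^ k / 2 * raisedAvg f k (r, y)) ht, descent,
    integral_angleMeasure (fun α => raisedAvg f k (t * Real.sin α, y) * Real.sin α)]
  simp only [mul_assoc ((-1 : ℝ) ^ k / 2)]
  rw [intervalIntegral.integral_const_mul]
  have : (-1 / Real.pi) ^ k * (-1) ^ k = (1 / Real.pi) ^ k := by
    rw [← mul_pow]
    congr 1
    ring
  rw [← this]
  ring

/-- After `k` steps the parameter is `n - 1 - 2k`: it is 2 for odd `n`, and 1 for even `n`, where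
the descent supplies the rest. The remaining computation checks `V(0, y) = f(y)`. -/
theorem isCauchySolution_transmit {f : Euc n → ℝ} (hf : ContDiff ℝ ∞ f) (hn : 2 ≤ n) :
    IsCauchySolution f (transmit f) := by
  have hS := contDiff_raisedAvg hf ((n - 2) / 2)
  have hE := isEPD_raisedAvg hf ((n - 2) / 2)
  have hpi := Real.pi_pos
  rcases Nat.even_or_odd n with heven | hodd
  · obtain ⟨m, hm⟩ := heven
    have hk : (n : ℝ) = 2 * ((n - 2) / 2 : ℕ) + 2 := by
      have : n = 2 * ((n - 2) / 2) + 2 := by omega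
      exact_mod_cast this
    have hE1 : IsEPD 1 (raisedAvg f ((n - 2) / 2)) := by
      convert hE using 1
      linarith
    refine isCauchySolution_of_isEPD (contDiff_const.mul (contDiff_descent hS))
      ((isEPD_descent hS hE1).const_mul (contDiff_descent hS) _) (fun y => ?_)
      fun t ht y => transmit_of_even hf hn ⟨m, hm⟩ ht y
    have h := prod_half_mul_sphereMeasure hn ((n - 2) / 2) 1 one_pos (by linarith)
    have hpow : √Real.pi ^ n = Real.pi * Real.pi ^ ((n - 2) / 2) := by
      conv_lhs => rw [show n = 2 * ((n - 2) / 2 + 1) by omega, pow_mul, Real.sq_sqrt hpi.le]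
      ring
    rw [descent_zero_left, raisedAvg_zero_left, ← mul_assoc (∏ i ∈ _, _), h, hpow, Real.Gamma_one]
    simp only [one_div, inv_pow]
    field_simp
  · obtain ⟨m, hm⟩ := hodd
    have hk : (n : ℝ) = 2 * ((n - 2) / 2 : ℕ) + 3 := by
      have : n = 2 * ((n - 2) / 2) + 3 := by omega
      exact_mod_cast this
    have hE1 : IsEPD 2 (raisedAvg f ((n - 2) / 2)) := by
      convert hE using 1
      linarith
    refine isCauchySolution_of_isEPD (contDiff_const.mul hS) (hE1.const_mul hS _) (fun y => ?_)
      fun t ht y => transmit_of_odd hf hn ⟨m, hm⟩ ht y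
    have h := prod_half_mul_sphereMeasure hn ((n - 2) / 2) (1 / 2 + 1) (by norm_num) (by linarith)
    have hpow : √Real.pi ^ n = √Real.pi * Real.pi * Real.pi ^ ((n - 2) / 2) := by
      conv_lhs => rw [show n = 2 * ((n - 2) / 2 + 1) + 1 by omega, pow_succ, pow_mul,
        Real.sq_sqrt hpi.le]
      ring
    have hs : 0 < √Real.pi := Real.sqrt_pos.2 hpi
    rw [raisedAvg_zero_left, ← mul_assoc (∏ i ∈ _, _), h, hpow, Real.Gamma_add_one (by norm_num),
      Real.Gamma_one_half_eq]
    simp only [one_div, inv_pow]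
    field_simp
    ring

end

/-! ### Abel integrals -/

/-- The Abel integral `∫₀^∞ q(τ - s) s^{-1/2} ds`. -/
def abel (q : ℝ → ℝ) (τ : ℝ) : ℝ := ∫ s in Ioi (0 : ℝ), q (τ - s) / √s

/-- By the conventions for `√` and division, `1/√s` already is `s₊^(-1/2)`; this makes `abel` a
convolution on the line. -/
theorem abel_eq_integral (q : ℝ → ℝ) (τ : ℝ) : abel q τ = ∫ s, q (τ - s) / √s := by
  refine setIntegral_eq_integral_of_forall_compl_eq_zero fun s hs => ?_
  rw [Real.sqrt_eq_zero_of_nonpos (not_lt.1 hs), div_zero]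

theorem abel_eq_integral_sub (q : ℝ → ℝ) (τ : ℝ) : abel q τ = ∫ y, q y / √(τ - y) := by
  rw [abel_eq_integral, ← integral_sub_left_eq_self (fun y => q y / √(τ - y)) volume τ]
  simp

theorem locallyIntegrable_inv_sqrt : LocallyIntegrable (fun s : ℝ => (√s)⁻¹) := by
  rw [locallyIntegrable_iff]
  intro K hK
  obtain ⟨b, hb⟩ := hK.isBounded.subset_closedBall 0
  have hKb : K ⊆ Iic 0 ∪ Ioc 0 b := by
    intro x hx
    have h := hb hx
    rw [Real.closedBall_eq_Icc] at h
    rcases le_or_gt x 0 with h0 | h0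
    · exact Or.inl h0
    · exact Or.inr ⟨h0, by simpa using h.2⟩
  refine IntegrableOn.mono_set (IntegrableOn.union ?_ ?_) hKb
  · refine integrableOn_zero.congr_fun (fun s hs => ?_) measurableSet_Iic
    simp [Real.sqrt_eq_zero_of_nonpos hs]
  · refine intervalIntegral.integrableOn_deriv_of_nonneg (g := fun s => 2 * √s) (by fun_prop)
      (fun x hx => ?_) fun x _ => by positivity
    refine ((Real.hasDerivAt_sqrt hx.1.ne').const_mul 2).congr_deriv ?_
    have : 0 < √x := Real.sqrt_pos.2 hx.1
    field_simp

theorem integrable_div_sqrt {q : ℝ → ℝ} (hq : Continuous q) (hc : HasCompactSupport q) (τ : ℝ) :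
    Integrable (fun y => q y / √(τ - y)) := by
  have h : Integrable (fun s => (√s)⁻¹ * q (τ - s)) :=
    locallyIntegrable_inv_sqrt.integrable_smul_right_of_hasCompactSupport
      (hq.comp (continuous_const.sub continuous_id))
      (hc.comp_homeomorph (Homeomorph.subLeft τ))
  refine (h.comp_sub_left τ).congr (Eventually.of_forall fun y => ?_)
  simp only [sub_sub_cancel]
  rw [div_eq_mul_inv, mul_comm]

/-- In the convolution with the locally integrable kernel `s₊^(-1/2)` the derivative may be put on
`q`. -/
theorem hasDerivAt_abel {q : ℝ → ℝ} (hq : ContDiff ℝ 1 q) (hc : HasCompactSupport q) (τ : ℝ) :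
    HasDerivAt (abel q) (abel (deriv q) τ) τ := by
  have h := hc.hasDerivAt_convolution_right (ContinuousLinearMap.mul ℝ ℝ)
    (μ := volume) locallyIntegrable_inv_sqrt hq τ
  have key : ∀ (q : ℝ → ℝ) (τ : ℝ),
      (convolution (fun s : ℝ => (√s)⁻¹) q (ContinuousLinearMap.mul ℝ ℝ) volume) τ = abel q τ := by
    intro q τ
    rw [convolution_def, abel_eq_integral]
    congr 1
    funext s
    rw [ContinuousLinearMap.mul_apply', div_eq_mul_inv, mul_comm]
  rw [key] at h
  exact h.congr_of_eventuallyEq (Eventually.of_forall fun τ => (key q τ).symm)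

theorem iteratedDeriv_abel (j : ℕ) {q : ℝ → ℝ} (hq : ContDiff ℝ ∞ q) (hc : HasCompactSupport q) :
    iteratedDeriv j (abel q) = abel (iteratedDeriv j q) := by
  induction j generalizing q with
  | zero => simp
  | succ j ih =>
    rw [iteratedDeriv_succ', iteratedDeriv_succ',
      show deriv (abel q) = abel (deriv q) from
        funext fun τ => (hasDerivAt_abel (contDiff_infty.1 hq 1) hc τ).deriv]
    exact ih (contDiff_infty_iff_deriv.1 hq).2 hc.deriv

/-! ### The logarithmic kernel -/

/-- A primitive of `s^{-1/2} (s + c)^{-1/2}`. -/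
def logSum (c s : ℝ) : ℝ := 2 * Real.log (√s + √(s + c))

theorem hasDerivAt_logSum {c s : ℝ} (hs : 0 < s) (hc : 0 < s + c) :
    HasDerivAt (logSum c) (1 / √s * (1 / √(s + c))) s := by
  have h1 : 0 < √s := Real.sqrt_pos.2 hs
  have h2 : 0 < √(s + c) := Real.sqrt_pos.2 hc
  have hd := (((Real.hasDerivAt_sqrt hs.ne').add
    (((hasDerivAt_id s).add_const c).sqrt hc.ne')).log (add_pos h1 h2).ne').const_mul 2
  refine hd.congr_deriv ?_
  simp only [id, Pi.add_apply]
  field_simp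
  ring

theorem continuousAt_logSum {c s : ℝ} (h : 0 < √s + √(s + c)) : ContinuousAt (logSum c) s := by
  have h1 : ContinuousAt (fun s => √s + √(s + c)) s := by fun_prop
  exact (h1.log h.ne').const_mul 2

/-- The limit does not depend on `c`, so the difference of two such primitives tends to 0 at
infinity. -/
theorem tendsto_logSum_sub_log (c : ℝ) :
    Tendsto (fun s => logSum c s - Real.log s) atTop (𝓝 (2 * Real.log 2)) := by
  have h1 : Tendsto (fun s : ℝ => 1 + √(1 + c / s)) atTop (𝓝 2) := by
    have h := ((tendsto_const_nhds (x := c)).div_atTop tendsto_id).const_add 1 |>.sqrt |>.const_add 1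
    simp only [add_zero, Real.sqrt_one] at h
    norm_num at h
    exact h
  refine ((h1.log two_ne_zero).const_mul 2).congr' ?_
  filter_upwards [eventually_gt_atTop 0] with s hs
  have hsq : 0 < √s := Real.sqrt_pos.2 hs
  have h2 : √s + √(s + c) = √s * (1 + √(1 + c / s)) := by
    rw [mul_add, mul_one, ← Real.sqrt_mul hs.le, mul_add, mul_one, mul_div_cancel₀ _ hs.ne']
  rw [logSum, h2, Real.log_mul hsq.ne' (by positivity), Real.log_sqrt hs.le]
  ring

theorem tendsto_logSum_sub_logSum (c d : ℝ) :
    Tendsto (fun s => logSum c s - logSum d s) atTop (𝓝 0) := by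
  have h := (tendsto_logSum_sub_log c).sub (tendsto_logSum_sub_log d)
  simpa using h

/-- The kernel `s^{-1/2} ((s - y)₊^{-1/2} - (s + B)^{-1/2})`. -/
def logKernel (B y s : ℝ) : ℝ := 1 / √s * (1 / √(s - y) - 1 / √(s + B))

theorem logKernel_of_nonpos (B y : ℝ) {s : ℝ} (hs : s ≤ 0) : logKernel B y s = 0 := by
  simp [logKernel, Real.sqrt_eq_zero_of_nonpos hs]

theorem logKernel_nonneg {B y s : ℝ} (hB : -B < y) (hs : y < s) : 0 ≤ logKernel B y s := by
  have h1 : 0 < √(s - y) := Real.sqrt_pos.2 (by linarith)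
  have h2 : 1 / √(s + B) ≤ 1 / √(s - y) :=
    one_div_le_one_div_of_le h1 (Real.sqrt_le_sqrt (by linarith))
  exact mul_nonneg (by positivity) (by linarith)

/-- Beyond `a` the kernel is the nonnegative derivative of `logSum (-y) - logSum B`, which tends to
0 at infinity; this gives integrability together with the value. Hypothesis `h` keeps the logarithm
continuous at the endpoint. -/
theorem logKernel_tail {B y a : ℝ} (hB : -B < y) (ha : 0 ≤ a) (hay : y ≤ a)
    (h : 0 < √a + √(a - y)) :
    IntegrableOn (logKernel B y) (Ioi a) ∧
      ∫ s in Ioi a, logKernel B y s = logSum B a - logSum (-y) a := by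
  have haB : 0 < a + B := by linarith
  have hcont : ContinuousWithinAt (fun s => logSum (-y) s - logSum B s) (Ici a) a := by
    refine ((continuousAt_logSum ?_).sub (continuousAt_logSum ?_)).continuousWithinAt
    · rw [← sub_eq_add_neg]; exact h
    · have := Real.sqrt_pos.2 haB
      positivity
  have hder : ∀ s ∈ Ioi a, HasDerivAt (fun s => logSum (-y) s - logSum B s) (logKernel B y s) s := by
    intro s hs
    have hs' : a < s := hs
    refine ((hasDerivAt_logSum (by linarith) (by linarith)).sub
      (hasDerivAt_logSum (c := B) (by linarith) (by linarith))).congr_deriv ?_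
    rw [logKernel, ← sub_eq_add_neg]
    ring
  have hpos : ∀ s ∈ Ioi a, 0 ≤ logKernel B y s := fun s hs =>
    logKernel_nonneg hB (lt_of_le_of_lt hay hs)
  refine ⟨integrableOn_Ioi_deriv_of_nonneg hcont hder hpos (tendsto_logSum_sub_logSum _ _), ?_⟩
  rw [integral_Ioi_of_hasDerivAt_of_nonneg hcont hder hpos (tendsto_logSum_sub_logSum _ _)]
  ring

theorem logSum_zero_right {c : ℝ} (hc : 0 ≤ c) : logSum c 0 = Real.log c := by
  rw [logSum, Real.sqrt_zero, zero_add, zero_add, Real.log_sqrt hc]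
  ring

theorem logSum_neg_self {y : ℝ} (hy : 0 ≤ y) : logSum (-y) y = Real.log y := by
  rw [logSum, add_neg_cancel, Real.sqrt_zero, add_zero, Real.log_sqrt hy]
  ring

theorem logSum_sub_log_le {B y : ℝ} (hB : 0 < B) (hy0 : 0 < y) (hy : y ≤ B) :
    logSum B y - Real.log B ≤ 4 := by
  have hB' : 0 < √B := Real.sqrt_pos.2 hB
  have h0 : 0 < √y + √(y + B) := by
    have := Real.sqrt_pos.2 hy0
    positivity
  have h1 : √y ≤ √B := Real.sqrt_le_sqrt hy
  have h2 : √(y + B) ≤ 2 * √B := by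
    rw [show 2 * √B = √(4 * B) by
      rw [Real.sqrt_mul (by norm_num), show (4 : ℝ) = 2 ^ 2 by norm_num, Real.sqrt_sq (by norm_num)]]
    exact Real.sqrt_le_sqrt (by linarith)
  have h3 : Real.log (√y + √(y + B)) ≤ Real.log (3 * √B) := Real.log_le_log h0 (by linarith)
  rw [Real.log_mul (by norm_num) hB'.ne', Real.log_sqrt hB.le] at h3
  have h4 : Real.log 3 ≤ 2 := by
    have := Real.log_le_sub_one_of_pos (show (0 : ℝ) < 3 by norm_num)
    linarith
  rw [logSum]
  linarith

/-- The subtracted term makes the integral converge at infinity, and what remains is the logarithm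
(`Real.log y` means `log |y|`). For `y > 0` the kernel is nonpositive on `(0, y]`; taking absolute
values adds twice the mass of that piece, which is at most 4 by `logSum_sub_log_le`. -/
theorem logKernel_integral {B y : ℝ} (hy0 : y ≠ 0) (hy1 : -B < y) (hy2 : y < B) :
    Integrable (logKernel B y) ∧ ∫ s, logKernel B y s = Real.log B - Real.log y ∧
      ∫ s, |logKernel B y s| ≤ Real.log B - Real.log y + 8 := by
  have hB : 0 < B := by linarith
  have hsupp : ∀ s ∉ Ioi (0 : ℝ), logKernel B y s = 0 := fun s hs =>
    logKernel_of_nonpos B y (not_lt.1 hs)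
  rw [← setIntegral_eq_integral_of_forall_compl_eq_zero hsupp,
    ← setIntegral_eq_integral_of_forall_compl_eq_zero
      (f := fun s => |logKernel B y s|) (s := Ioi 0) (fun s hs => by rw [hsupp s hs, abs_zero])]
  rcases lt_or_gt_of_ne hy0 with hy | hy
  · obtain ⟨hint, hval⟩ := logKernel_tail hy1 le_rfl hy.le (by
      have := Real.sqrt_pos.2 (show 0 < 0 - y by linarith)
      positivity)
    have habs : ∫ s in Ioi (0 : ℝ), |logKernel B y s| = ∫ s in Ioi (0 : ℝ), logKernel B y s :=
      setIntegral_congr_fun measurableSet_Ioi fun s hs =>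
        abs_of_nonneg (logKernel_nonneg hy1 (lt_trans hy hs))
    rw [logSum_zero_right hB.le, logSum_zero_right (by linarith), Real.log_neg_eq_log] at hval
    exact ⟨hint.integrable_of_forall_notMem_eq_zero hsupp, hval, by rw [habs, hval]; linarith⟩
  · obtain ⟨hint, hval⟩ := logKernel_tail hy1 hy.le le_rfl (by
      have := Real.sqrt_pos.2 hy
      positivity)
    have hcontOn : ContinuousOn (logSum B) (Icc 0 y) := fun s hs =>
      (continuousAt_logSum (by
        have := Real.sqrt_pos.2 (show 0 < s + B by linarith [hs.1])
        positivity)).continuousWithinAt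
    have hder : ∀ s ∈ Ioo 0 y, HasDerivAt (logSum B) (1 / √s * (1 / √(s + B))) s := fun s hs =>
      hasDerivAt_logSum hs.1 (by linarith [hs.1])
    have hint0 : IntegrableOn (fun s => 1 / √s * (1 / √(s + B))) (Ioc 0 y) :=
      intervalIntegral.integrableOn_deriv_of_nonneg hcontOn hder fun s _ => by positivity
    have hval0 : ∫ s in Ioc 0 y, 1 / √s * (1 / √(s + B)) = logSum B y - Real.log B := by
      rw [← intervalIntegral.integral_of_le hy.le,
        intervalIntegral.integral_eq_sub_of_hasDerivAt_of_le hy.le hcontOn hder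
          ((intervalIntegrable_iff_integrableOn_Ioc_of_le hy.le).2 hint0), logSum_zero_right hB.le]
    -- For `s ≤ y` the term `1 / √(s - y)` is 0 by convention.
    have hneg : EqOn (logKernel B y) (fun s => -(1 / √s * (1 / √(s + B)))) (Ioc 0 y) := by
      intro s hs
      simp only [logKernel, Real.sqrt_eq_zero_of_nonpos (show s - y ≤ 0 by linarith [hs.2])]
      ring
    have hint1 : IntegrableOn (logKernel B y) (Ioc 0 y) :=
      hint0.neg.congr_fun hneg.symm measurableSet_Ioc
    have hval1 : ∫ s in Ioc 0 y, logKernel B y s = -(logSum B y - Real.log B) := by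
      rw [setIntegral_congr_fun measurableSet_Ioc hneg, integral_neg, hval0]
    have hval2 : ∫ s in Ioc 0 y, |logKernel B y s| = logSum B y - Real.log B := by
      rw [← hval0]
      refine setIntegral_congr_fun measurableSet_Ioc fun s hs => ?_
      rw [hneg hs, abs_neg, abs_of_nonneg (by positivity)]
    have habs : ∫ s in Ioi y, |logKernel B y s| = ∫ s in Ioi y, logKernel B y s :=
      setIntegral_congr_fun measurableSet_Ioi fun s hs => abs_of_nonneg (logKernel_nonneg hy1 hs)
    have hunion : Ioi (0 : ℝ) = Ioc 0 y ∪ Ioi y := (Ioc_union_Ioi_eq_Ioi hy.le).symm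
    have hdisj : Disjoint (Ioc 0 y) (Ioi y) := Ioc_disjoint_Ioi le_rfl
    rw [logSum_neg_self hy.le] at hval
    have hIoi : IntegrableOn (logKernel B y) (Ioi 0) := by
      rw [hunion]; exact hint1.union hint
    refine ⟨hIoi.integrable_of_forall_notMem_eq_zero hsupp, ?_, ?_⟩
    · rw [hunion, setIntegral_union hdisj measurableSet_Ioi hint1 hint, hval, hval1]
      ring
    · rw [hunion, setIntegral_union hdisj measurableSet_Ioi hint1.abs hint.abs, habs, hval, hval2]
      linarith [logSum_sub_log_le hB hy hy2.le]

/-! ### Two Abel integrals give a principal value -/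

theorem integral_eq_integral_Ioi_add_neg {g : ℝ → ℝ} (hg : Integrable g) :
    ∫ y, g y = ∫ y in Ioi (0 : ℝ), (g y + g (-y)) := by
  have hneg : IntegrableOn (fun y => g (-y)) (Ioi 0) := hg.comp_neg.integrableOn
  rw [integral_add hg.integrableOn hneg, integral_comp_neg_Ioi 0 g, neg_zero, add_comm,
    ← intervalIntegral.integral_Iic_add_Ioi hg.integrableOn hg.integrableOn]

theorem measurable_logKernel (B : ℝ) : Measurable fun z : ℝ × ℝ => logKernel B z.2 z.1 := by
  unfold logKernel
  fun_prop

/-- This licenses Fubini: the `s`-integral of the absolute value is at most `C (log B - log |y| +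
8)`, and the logarithm is integrable on `(-B, B]`. -/
theorem integrable_mul_logKernel {q : ℝ → ℝ} (hq : Continuous q) {B : ℝ} (hB : 0 < B)
    (hsupp : ∀ y, B ≤ |y| → q y = 0) :
    Integrable (fun z : ℝ × ℝ => q z.2 * logKernel B z.2 z.1) (volume.prod volume) := by
  have hmeas : AEStronglyMeasurable (fun z : ℝ × ℝ => q z.2 * logKernel B z.2 z.1)
      (volume.prod volume) :=
    ((hq.measurable.comp measurable_snd).mul (measurable_logKernel B)).aestronglyMeasurable
  obtain ⟨C, hC⟩ := (isCompact_Icc (a := -B) (b := B)).exists_bound_of_continuousOn hq.continuousOn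
  have hC0 : 0 ≤ C := (norm_nonneg _).trans (hC 0 ⟨by linarith, hB.le⟩)
  have hae : ∀ᵐ y : ℝ, y ≠ 0 := Measure.ae_ne volume 0
  refine (integrable_prod_iff' hmeas).2 ⟨?_, ?_⟩
  · filter_upwards [hae] with y hy
    rcases le_or_gt B |y| with h | h
    · simp [hsupp y h]
    · exact ((logKernel_integral hy (abs_lt.1 h).1 (abs_lt.1 h).2).1).const_mul _
  · have hlog : IntegrableOn (fun y => C * (Real.log B - Real.log y + 8)) (Ioc (-B) B) := by
      have h1 : IntegrableOn Real.log (Ioc (-B) B) :=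
        (intervalIntegrable_iff_integrableOn_Ioc_of_le (by linarith)).1
          intervalIntegral.intervalIntegrable_log'
      have h2 : IntegrableOn (fun _ : ℝ => Real.log B) (Ioc (-B) B) :=
        integrableOn_const (by simp)
      have h3 : IntegrableOn (fun _ : ℝ => (8 : ℝ)) (Ioc (-B) B) := integrableOn_const (by simp)
      exact ((h2.sub h1).add h3).const_mul C
    refine Integrable.mono' ((integrable_indicator_iff measurableSet_Ioc).2 hlog)
      hmeas.norm.prod_swap.integral_prod_right' ?_
    filter_upwards [hae] with y hy
    simp only [norm_mul, Real.norm_eq_abs]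
    rw [integral_const_mul, abs_mul, abs_abs,
      abs_of_nonneg (integral_nonneg fun s => abs_nonneg (logKernel B y s))]
    rcases le_or_gt B |y| with h | h
    · rw [hsupp y h, abs_zero, zero_mul]
      simp only [indicator]
      split_ifs with hy'
      · have hlogy : Real.log y ≤ Real.log B := by
          rw [← Real.log_abs y]
          exact Real.log_le_log (abs_pos.2 hy) (abs_le.2 ⟨hy'.1.le, hy'.2⟩)
        exact mul_nonneg hC0 (by linarith)
      · exact le_rfl
    · have hm : y ∈ Ioc (-B) B := ⟨(abs_lt.1 h).1, (abs_lt.1 h).2.le⟩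
      rw [indicator_of_mem hm]
      have hk := (logKernel_integral hy (abs_lt.1 h).1 (abs_lt.1 h).2).2.2
      exact mul_le_mul (hC y ⟨hm.1.le, hm.2⟩) hk
        (integral_nonneg fun s => abs_nonneg (logKernel B y s)) hC0

theorem exists_bound_sub_neg {h : ℝ → ℝ} (hh : ContDiff ℝ 1 h) (hc : HasCompactSupport h) :
    ∃ C : ℝ, 0 ≤ C ∧ ∀ z, |h z - h (-z)| ≤ C * |z| := by
  obtain ⟨C, hC⟩ := hh.lipschitzWith_of_hasCompactSupport hc one_ne_zero
  refine ⟨C * 2, by positivity, fun z => ?_⟩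
  have := hC.dist_le_mul z (-z)
  rw [Real.dist_eq, Real.dist_eq, sub_neg_eq_add, ← two_mul, abs_mul, abs_two, ← mul_assoc] at this
  exact this

theorem exists_pos_bound_support {h : ℝ → ℝ} (hc : HasCompactSupport h) :
    ∃ B : ℝ, 0 < B ∧ ∀ y, B ≤ |y| → h y = 0 := by
  obtain ⟨B, hB⟩ := hc.isBounded.subset_ball 0
  refine ⟨max B 1, by positivity, fun y hy => ?_⟩
  by_contra hne
  have := hB (subset_tsupport h hne)
  rw [mem_ball_zero_iff, Real.norm_eq_abs] at this
  linarith [le_max_left B 1]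

theorem integrableOn_sub_neg_div {h : ℝ → ℝ} (hh : ContDiff ℝ 1 h) (hc : HasCompactSupport h) :
    IntegrableOn (fun z => (h z - h (-z)) / z) (Ioi 0) := by
  obtain ⟨C, hC0, hC⟩ := exists_bound_sub_neg hh hc
  obtain ⟨B, hB0, hB⟩ := exists_pos_bound_support hc
  have hbound : Integrable ((Icc (-B) B).indicator fun _ => C) :=
    (integrable_indicator_iff measurableSet_Icc).2 (integrableOn_const (by simp))
  have hm : Measurable fun z => (h z - h (-z)) / z := by
    have := hh.continuous.measurable
    fun_prop
  refine (Integrable.mono' hbound hm.aestronglyMeasurable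
    (Eventually.of_forall fun z => ?_)).integrableOn
  by_cases hz : z ∈ Icc (-B) B
  · rw [indicator_of_mem hz, norm_div, Real.norm_eq_abs, Real.norm_eq_abs]
    exact div_le_of_le_mul₀ (abs_nonneg _) hC0 (hC z)
  · rw [indicator_of_notMem hz]
    have hz' : B ≤ |z| := by
      by_contra hlt
      exact hz (abs_le.1 (not_le.1 hlt).le)
    rw [hB z hz', hB (-z) (by rwa [abs_neg]), sub_zero, zero_div, norm_zero]

/-- Fold the line onto the half-line and integrate by parts. The boundary term `(h z - h (-z)) log
z` is `O(|z log z|)` at 0 because `h` is Lipschitz, and it vanishes for large `z`. -/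
theorem integral_deriv_mul_log {h : ℝ → ℝ} (hh : ContDiff ℝ ∞ h) (hc : HasCompactSupport h) :
    ∫ y, deriv h y * Real.log y = -∫ z in Ioi (0 : ℝ), (h z - h (-z)) / z := by
  have hh1 : ContDiff ℝ 1 h := contDiff_infty.1 hh 1
  have hd : Continuous (deriv h) := hh1.continuous_deriv le_rfl
  obtain ⟨B, hB0, hB⟩ := exists_pos_bound_support hc.deriv
  obtain ⟨B', hB0', hB'⟩ := exists_pos_bound_support hc
  obtain ⟨C, hC0, hC⟩ := exists_bound_sub_neg hh1 hc
  have hint : Integrable (fun y => deriv h y * Real.log y) := by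
    have h1 : IntegrableOn (fun y => deriv h y * Real.log y) (Icc (-B) B) :=
      IntegrableOn.continuousOn_mul hd.continuousOn
        ((intervalIntegrable_iff_integrableOn_Icc_of_le (by linarith)).1
          intervalIntegral.intervalIntegrable_log') isCompact_Icc
    refine h1.integrable_of_forall_notMem_eq_zero fun y hy => ?_
    rw [hB y, zero_mul]
    by_contra hlt
    exact hy (abs_le.1 (not_le.1 hlt).le)
  have hder : ∀ z ∈ Ioi (0 : ℝ), HasDerivAt (fun z => (h z - h (-z)) * Real.log z)
      ((deriv h z * Real.log z + deriv h (-z) * Real.log (-z)) + (h z - h (-z)) / z) z := by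
    intro z hz
    have e1 := (hh1.differentiable one_ne_zero z).hasDerivAt
    have e2 := ((hh1.differentiable one_ne_zero (-z)).hasDerivAt).comp z (hasDerivAt_neg z)
    refine ((e1.sub e2).mul (Real.hasDerivAt_log (ne_of_gt hz))).congr_deriv ?_
    simp only [Pi.sub_apply, Function.comp, Real.log_neg_eq_log]
    ring
  have hcont : ContinuousWithinAt (fun z => (h z - h (-z)) * Real.log z) (Ici 0) 0 := by
    refine ContinuousAt.continuousWithinAt ?_
    rw [ContinuousAt, neg_zero, sub_self, zero_mul]
    have hlim : Tendsto (fun z : ℝ => C * |z * Real.log z|) (𝓝 0) (𝓝 0) := by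
      have := (Real.continuous_mul_log.abs.const_mul C).tendsto 0
      simpa using this
    refine squeeze_zero_norm (fun z => ?_) hlim
    rw [norm_mul, abs_mul, ← mul_assoc]
    exact mul_le_mul_of_nonneg_right (hC z) (norm_nonneg _)
  have htop : Tendsto (fun z => (h z - h (-z)) * Real.log z) atTop (𝓝 0) := by
    refine tendsto_const_nhds.congr' ?_
    filter_upwards [eventually_ge_atTop B'] with z hz
    have hz' : B' ≤ |z| := hz.trans (le_abs_self z)
    rw [hB' z hz', hB' (-z) (by rwa [abs_neg]), sub_zero, zero_mul]
  have hI1 : IntegrableOn (fun z => deriv h z * Real.log z + deriv h (-z) * Real.log (-z)) (Ioi 0) :=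
    hint.integrableOn.add hint.comp_neg.integrableOn
  have hI2 := integrableOn_sub_neg_div hh1 hc
  have key := integral_Ioi_of_hasDerivAt_of_tendsto hcont hder (hI1.add hI2) htop
  rw [integral_add hI1 hI2] at key
  rw [integral_eq_integral_Ioi_add_neg hint]
  simp only [neg_zero, sub_self, zero_mul] at key
  linarith

/-- Fubini is barred for the raw kernel `s^(-1/2) (s-y)₊^(-1/2)`, which is not integrable at
infinity. Since `∫ h' = 0`, it may be replaced by `logKernel B`; the swap gives `∫ h'(y) (log B -
log |y|) dy`, where `log B` drops out for the same reason. -/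
theorem integral_abel_deriv {h : ℝ → ℝ} (hh : ContDiff ℝ ∞ h) (hc : HasCompactSupport h) :
    ∫ s in Ioi (0 : ℝ), abel (deriv h) s / √s = ∫ z in Ioi (0 : ℝ), (h z - h (-z)) / z := by
  have hh1 : ContDiff ℝ 1 h := contDiff_infty.1 hh 1
  have hd : Continuous (deriv h) := hh1.continuous_deriv le_rfl
  obtain ⟨B, hB0, hB⟩ := exists_pos_bound_support hc.deriv
  have hdint : Integrable (deriv h) := hd.integrable_of_hasCompactSupport hc.deriv
  have hzero : ∫ y, deriv h y = 0 :=
    integral_eq_zero_of_hasDerivAt_of_integrable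
      (fun y => (hh1.differentiable one_ne_zero y).hasDerivAt) hdint
      (hh.continuous.integrable_of_hasCompactSupport hc)
  have hF := integrable_mul_logKernel hd hB0 hB
  have hs : ∀ s, abel (deriv h) s / √s = ∫ y, deriv h y * logKernel B y s := by
    intro s
    have e : ∀ y, deriv h y * logKernel B y s
        = 1 / √s * (deriv h y / √(s - y)) - 1 / √s * (1 / √(s + B)) * deriv h y := by
      intro y
      rw [logKernel]
      ring
    simp only [e]
    rw [integral_sub ((integrable_div_sqrt hd hc.deriv s).const_mul _) (hdint.const_mul _),
      integral_const_mul, integral_const_mul, hzero, ← abel_eq_integral_sub]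
    ring
  have hy : ∀ᵐ y : ℝ, ∫ s, deriv h y * logKernel B y s
      = deriv h y * Real.log B - deriv h y * Real.log y := by
    filter_upwards [Measure.ae_ne volume 0] with y hy0
    rcases le_or_gt B |y| with hBy | hBy
    · simp [hB y hBy]
    · rw [integral_const_mul, (logKernel_integral hy0 (abs_lt.1 hBy).1 (abs_lt.1 hBy).2).2.1, mul_sub]
  have hlogint : Integrable (fun y => deriv h y * Real.log y) := by
    have h1 : IntegrableOn (fun y => deriv h y * Real.log y) (Icc (-B) B) :=
      IntegrableOn.continuousOn_mul hd.continuousOn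
        ((intervalIntegrable_iff_integrableOn_Icc_of_le (by linarith)).1
          intervalIntegral.intervalIntegrable_log') isCompact_Icc
    refine h1.integrable_of_forall_notMem_eq_zero fun y hy => ?_
    rw [hB y, zero_mul]
    by_contra hlt
    exact hy (abs_le.1 (not_le.1 hlt).le)
  rw [setIntegral_eq_integral_of_forall_compl_eq_zero (fun s hs => by
    rw [Real.sqrt_eq_zero_of_nonpos (not_lt.1 hs), div_zero])]
  simp only [hs]
  rw [integral_integral_swap (f := fun s y => deriv h y * logKernel B y s) hF, integral_congr_ae hy,
    integral_sub (hdint.mul_const _) hlogint, integral_mul_const, hzero, integral_deriv_mul_log hh hc]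
  ring

/-- Folding at 0 turns the singular integrand into `(h z - h (-z)) / z`, which is integrable and
dominates its own truncations. -/
theorem tendsto_integral_truncated {h : ℝ → ℝ} (hh : ContDiff ℝ ∞ h) (hc : HasCompactSupport h) :
    Tendsto (fun ε => ∫ z in {z : ℝ | ε ≤ |z|}, h z / z) (𝓝[>] 0)
      (𝓝 (∫ z in Ioi (0 : ℝ), (h z - h (-z)) / z)) := by
  have hh1 : ContDiff ℝ 1 h := contDiff_infty.1 hh 1
  have hhm := hh.continuous.measurable
  have hmset : ∀ ε : ℝ, MeasurableSet {z : ℝ | ε ≤ |z|} := fun ε =>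
    measurableSet_le measurable_const measurable_id.abs
  have hmz : Measurable fun z => h z / z := by fun_prop
  have heq : ∀ ε > 0, ∫ z in {z : ℝ | ε ≤ |z|}, h z / z
      = ∫ z in Ioi (0 : ℝ), {z : ℝ | ε ≤ |z|}.indicator (fun z => (h z - h (-z)) / z) z := by
    intro ε hε
    have hint : Integrable ({z : ℝ | ε ≤ |z|}.indicator fun z => h z / z) := by
      have hb : Integrable (fun z => |h z| / ε) :=
        ((hh.continuous.integrable_of_hasCompactSupport hc).abs).div_const ε
      refine Integrable.mono' hb (hmz.indicator (hmset ε)).aestronglyMeasurable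
        (Eventually.of_forall fun z => ?_)
      by_cases hz : z ∈ {z : ℝ | ε ≤ |z|}
      · rw [indicator_of_mem hz, norm_div, Real.norm_eq_abs, Real.norm_eq_abs]
        exact div_le_div_of_nonneg_left (abs_nonneg _) hε hz
      · rw [indicator_of_notMem hz, norm_zero]
        positivity
    rw [← integral_indicator (hmset ε), integral_eq_integral_Ioi_add_neg hint]
    refine setIntegral_congr_fun measurableSet_Ioi fun z _ => ?_
    by_cases hz : ε ≤ |z|
    · simp only [indicator, mem_ofPred_eq, abs_neg, hz, if_true]
      ring
    · simp only [indicator, mem_ofPred_eq, abs_neg, hz, if_false]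
      ring
  have hlim : Tendsto (fun ε => ∫ z in Ioi (0 : ℝ),
      {z : ℝ | ε ≤ |z|}.indicator (fun z => (h z - h (-z)) / z) z) (𝓝[>] 0)
      (𝓝 (∫ z in Ioi (0 : ℝ), (h z - h (-z)) / z)) := by
    refine tendsto_integral_filter_of_dominated_convergence
      (fun z => ‖(h z - h (-z)) / z‖) (Eventually.of_forall fun ε => ?_)
      (Eventually.of_forall fun ε => Eventually.of_forall fun z => norm_indicator_le_norm_self _ _)
      (integrableOn_sub_neg_div hh1 hc).norm ?_
    · have : Measurable fun z => (h z - h (-z)) / z := by fun_prop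
      exact (this.indicator (hmset ε)).aestronglyMeasurable
    · refine (ae_restrict_iff' measurableSet_Ioi).2 (Eventually.of_forall fun z hz => ?_)
      refine tendsto_const_nhds.congr' ?_
      have hz0 : (0 : ℝ) < z := hz
      filter_upwards [nhdsWithin_le_nhds (gt_mem_nhds hz0)] with ε hε
      have hz' : z ∈ {z : ℝ | ε ≤ |z|} := (le_of_lt hε).trans (le_abs_self z)
      rw [indicator_of_mem hz']
  refine hlim.congr' ?_
  filter_upwards [self_mem_nhdsWithin] with ε hε using (heq ε hε).symm

/-- Substitute `y = r²` and shift by `ρ²`. The constraint `y > 0` can be dropped because `h`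
vanishes on the rest. -/
theorem truncatedIntegral_eq {H h : ℝ → ℝ} {c : ℝ} (hH : ∀ r > 0, H r = c * h (r ^ 2))
    (h0 : ∀ y ≤ 0, h y = 0) (ρ ε : ℝ) :
    truncatedIntegral H ρ ε = c * ∫ z in {z : ℝ | ε ≤ |z|}, h (ρ ^ 2 + z) / z := by
  let S : Set ℝ := {r : ℝ | 0 < r ∧ ε ≤ |r ^ 2 - ρ ^ 2|}
  have hS : MeasurableSet S :=
    measurableSet_Ioi.inter (measurableSet_le measurable_const
      ((measurable_id.pow_const 2).sub_const _).abs)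
  have himg : (fun r : ℝ => r ^ 2) '' S = {y : ℝ | 0 < y ∧ ε ≤ |y - ρ ^ 2|} := by
    ext y
    constructor
    · rintro ⟨r, ⟨hr, hr'⟩, rfl⟩
      exact ⟨pow_pos hr 2, hr'⟩
    · rintro ⟨hy, hy'⟩
      refine ⟨√y, ⟨Real.sqrt_pos.2 hy, ?_⟩, Real.sq_sqrt hy.le⟩
      rwa [Real.sq_sqrt hy.le]
  have hinj : InjOn (fun r : ℝ => r ^ 2) S := fun r hr r' hr' he =>
    (pow_left_inj₀ hr.1.le hr'.1.le two_ne_zero).1 he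
  have hder : ∀ r ∈ S, HasDerivWithinAt (fun r : ℝ => r ^ 2) (2 * r) S r := fun r _ =>
    ((hasDerivAt_pow 2 r).congr_deriv (by simp)).hasDerivWithinAt
  have h1 : truncatedIntegral H ρ ε
      = ∫ y in {y : ℝ | 0 < y ∧ ε ≤ |y - ρ ^ 2|}, c * (h y / (y - ρ ^ 2)) := by
    rw [← himg, integral_image_eq_integral_abs_deriv_smul hS hder hinj, truncatedIntegral]
    refine setIntegral_congr_fun hS fun r hr => ?_
    have hr0 : 0 < r := hr.1
    simp only [smul_eq_mul]
    rw [hH r hr0, abs_of_pos (by positivity)]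
    ring
  have hm2 : MeasurableSet {y : ℝ | ε ≤ |y - ρ ^ 2|} :=
    measurableSet_le measurable_const (by fun_prop)
  have hm1 : MeasurableSet {y : ℝ | 0 < y ∧ ε ≤ |y - ρ ^ 2|} := measurableSet_Ioi.inter hm2
  have hm3 : MeasurableSet {z : ℝ | ε ≤ |z|} := measurableSet_le measurable_const (by fun_prop)
  rw [h1, integral_const_mul, ← integral_indicator hm1, ← integral_indicator hm3]
  congr 1
  rw [← integral_add_left_eq_self _ (ρ ^ 2)]
  congr 1
  funext z
  simp only [indicator, mem_ofPred_eq, add_sub_cancel_left]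
  by_cases hz : ε ≤ |z|
  · by_cases hp : 0 < ρ ^ 2 + z
    · simp [hz, hp]
    · simp [hz, hp, h0 _ (not_lt.1 hp)]
  · simp [hz]

section

/-! ### Smooth functions on the line -/

theorem contDiff_infty_iteratedDeriv {q : ℝ → ℝ} (hq : ContDiff ℝ ∞ q) (j : ℕ) :
    ContDiff ℝ ∞ (iteratedDeriv j q) := by
  induction j with
  | zero => simpa using hq
  | succ j ih =>
    rw [iteratedDeriv_succ]
    exact (contDiff_infty_iff_deriv.1 ih).2

theorem hasCompactSupport_iteratedDeriv {q : ℝ → ℝ} (hq : HasCompactSupport q) (j : ℕ) :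
    HasCompactSupport (iteratedDeriv j q) := by
  induction j with
  | zero => simpa using hq
  | succ j ih =>
    rw [iteratedDeriv_succ]
    exact ih.deriv

theorem iteratedDeriv_iteratedDeriv_add (i j : ℕ) (q : ℝ → ℝ) :
    iteratedDeriv i (iteratedDeriv j q) = iteratedDeriv (i + j) q := by
  simp only [iteratedDeriv_eq_iterate, Function.iterate_add_apply]

theorem iteratedDeriv_const_mul_comp_add (b a : ℝ) (k : ℕ) (q : ℝ → ℝ) (s : ℝ) :
    iteratedDeriv k (fun s => b * q (a + s)) s = b * iteratedDeriv k q (a + s) := by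
  rw [iteratedDeriv_const_mul_field, iteratedDeriv_comp_const_add]

theorem iteratedDeriv_const_mul_comp_sub (b a : ℝ) (k : ℕ) (q : ℝ → ℝ) (s : ℝ) :
    iteratedDeriv k (fun s => b * q (a - s)) s = b * ((-1) ^ k * iteratedDeriv k q (a - s)) := by
  rw [iteratedDeriv_const_mul_field, iteratedDeriv_comp_const_sub]
  simp

/-! ### The data on the mirror -/

variable {n : ℕ} {f : Euc n → ℝ} {ξ : Euc n}

/-- The function `R f(√σ, ξ) / √σ`. -/
def rootMean (f : Euc n → ℝ) (ξ : Euc n) (σ : ℝ) : ℝ := sphericalMean f √σ ξ / √σ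

theorem exists_rootMean_eq_zero (hξ : ξ ∉ tsupport f) :
    ∃ ε > 0, ∀ σ < ε, rootMean f ξ σ = 0 := by
  have hopen : IsOpen (tsupport f)ᶜ := (isClosed_tsupport f).isOpen_compl
  obtain ⟨δ, hδ, hball⟩ := Metric.isOpen_iff.1 hopen ξ hξ
  refine ⟨δ ^ 2, by positivity, fun σ hσ => ?_⟩
  have hlt : √σ < δ := (Real.sqrt_lt' hδ).2 hσ
  have hz : ∀ θ : Metric.sphere (0 : Euc n) 1, f (ξ + √σ • (θ : Euc n)) = 0 := by
    intro θ
    refine image_eq_zero_of_notMem_tsupport (hball ?_)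
    rw [Metric.mem_ball, dist_self_add_left, norm_smul, Real.norm_eq_abs,
      abs_of_nonneg (Real.sqrt_nonneg σ), norm_eq_of_mem_sphere, mul_one]
    exact hlt
  simp [rootMean, sphericalMean, hz]

/-- The square root is singular at `σ = 0`, but small spheres about `ξ` miss the support of `f`, so
the function is zero near and below 0. -/
theorem contDiff_rootMean (hf : ContDiff ℝ ∞ f) (hξ : ξ ∉ tsupport f) :
    ContDiff ℝ ∞ (rootMean f ξ) := by
  obtain ⟨ε, hε, hzero⟩ := exists_rootMean_eq_zero hξ
  refine contDiff_iff_contDiffAt.2 fun σ => ?_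
  rcases lt_or_ge σ ε with hσ | hσ
  · refine (contDiffAt_const (c := (0 : ℝ))).congr_of_eventuallyEq ?_
    filter_upwards [gt_mem_nhds hσ] with s hs using hzero s hs
  · have hσ0 : σ ≠ 0 := (hε.trans_le hσ).ne'
    have hs : ContDiffAt ℝ ∞ (fun σ : ℝ => √σ) σ := Real.contDiffAt_sqrt hσ0
    have hs0 : √σ ≠ 0 := (Real.sqrt_pos.2 (hε.trans_le hσ)).ne'
    exact ((hs.pow (n - 1)).mul ((contDiff_sphAvg hf).contDiffAt.comp σ
      (hs.prodMk contDiffAt_const))).div hs hs0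

theorem hasCompactSupport_rootMean (hfc : HasCompactSupport f) (ξ : Euc n) :
    HasCompactSupport (rootMean f ξ) := by
  obtain ⟨R, hR⟩ := hfc.isBounded.subset_closedBall ξ
  refine HasCompactSupport.intro (isCompact_Icc (a := 0) (b := R ^ 2)) fun σ hσ => ?_
  rcases lt_or_ge σ 0 with h | h
  · simp [rootMean, Real.sqrt_eq_zero_of_nonpos h.le]
  · have hσR : R ^ 2 < σ := not_le.1 fun hle => hσ ⟨h, hle⟩
    have hlt : R < √σ := Real.lt_sqrt_of_sq_lt hσR
    have hz : ∀ θ : Metric.sphere (0 : Euc n) 1, f (ξ + √σ • (θ : Euc n)) = 0 := by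
      intro θ
      refine image_eq_zero_of_notMem_tsupport fun hmem => ?_
      have := hR hmem
      rw [Metric.mem_closedBall, dist_self_add_left, norm_smul, Real.norm_eq_abs,
        abs_of_nonneg (Real.sqrt_nonneg σ), norm_eq_of_mem_sphere, mul_one] at this
      linarith
    simp [rootMean, sphericalMean, hz]

theorem iteratedDeriv_rootMean_of_nonpos (hξ : ξ ∉ tsupport f) (j : ℕ) {σ : ℝ} (hσ : σ ≤ 0) :
    iteratedDeriv j (rootMean f ξ) σ = 0 := by
  obtain ⟨ε, hε, hzero⟩ := exists_rootMean_eq_zero hξ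
  have hev : rootMean f ξ =ᶠ[𝓝 σ] fun _ => 0 := by
    filter_upwards [gt_mem_nhds (hσ.trans_lt hε)] with s hs using hzero s hs
  rw [hev.iteratedDeriv_eq]
  simp

/-- On functions of `σ = r²` the operator `(1/r) ∂_r` is `2 d/dσ`. -/
theorem filteredData_eq (hf : ContDiff ℝ ∞ f) (hξ : ξ ∉ tsupport f) {r : ℝ} (hr : 0 < r) :
    filteredData f ξ r = 2 ^ (n - 1) * iteratedDeriv (n - 1) (rootMean f ξ) (r ^ 2) := by
  have hg := contDiff_rootMean hf hξ
  have key : ∀ j : ℕ, ∀ r > 0, radialDeriv^[j] (fun r => sphericalMean f r ξ / r) r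
      = 2 ^ j * iteratedDeriv j (rootMean f ξ) (r ^ 2) := by
    intro j
    induction j with
    | zero =>
      intro r hr
      simp [rootMean, Real.sqrt_sq (le_of_lt hr)]
    | succ j ih =>
      intro r hr
      rw [Function.iterate_succ_apply', radialDeriv]
      have hev : radialDeriv^[j] (fun r => sphericalMean f r ξ / r) =ᶠ[𝓝 r]
          fun r => 2 ^ j * iteratedDeriv j (rootMean f ξ) (r ^ 2) := by
        filter_upwards [lt_mem_nhds hr] with s hs using ih s hs
      have hd := (((contDiff_infty_iteratedDeriv hg j).differentiable (by simp)
        (r ^ 2)).hasDerivAt.comp r (hasDerivAt_pow 2 r)).const_mul (2 ^ j)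
      rw [hev.deriv_eq]
      refine (congrArg (· / r) hd.deriv).trans ?_
      simp only [iteratedDeriv_succ]
      have : r ≠ 0 := ne_of_gt hr
      field_simp
      ring
  exact key (n - 1) r hr

/-- The operator taking the profile `q` of the data to that of the transmitted signal. -/
def signalOp (n : ℕ) (q : ℝ → ℝ) : ℝ → ℝ := open Classical in if Odd n then q else abel q

theorem hasDerivAt_signalOp (n : ℕ) {q : ℝ → ℝ} (hq : ContDiff ℝ ∞ q) (hc : HasCompactSupport q)
    (τ : ℝ) : HasDerivAt (signalOp n q) (signalOp n (deriv q) τ) τ := by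
  unfold signalOp
  split_ifs
  · exact (hq.differentiable (by simp) τ).hasDerivAt
  · exact hasDerivAt_abel (contDiff_infty.1 hq 1) hc τ

/-- Agreement is needed strictly to the left of 0 as well, since the kernel may evaluate derivatives
at 0. In the application `a = -|z|²`, which corresponds to `t > 0`. -/
theorem propagatorKernel_congr (n : ℕ) {φ ψ : ℝ → ℝ} {a : ℝ} (ha : a < 0)
    (h : ∀ s > a, φ s = ψ s) : propagatorKernel n φ = propagatorKernel n ψ := by
  have hk : ∀ s ≥ 0, iteratedDeriv ((n - 2) / 2) φ s = iteratedDeriv ((n - 2) / 2) ψ s := by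
    intro s hs
    refine Filter.EventuallyEq.iteratedDeriv_eq _ ?_
    filter_upwards [lt_mem_nhds (ha.trans_le hs)] with s hs using h s hs
  rw [propagatorKernel, propagatorKernel, hk 0 le_rfl,
    setIntegral_congr_fun measurableSet_Ioi fun s (hs : 0 < s) => by
      rw [hk s (le_of_lt hs)]]

/-- The sign `(-1)^k` of the distributional derivatives cancels the one from differentiating in `s`
through `t² - s`. -/
theorem transmit_eq (f : Euc n → ℝ) (ξ : Euc n) {t : ℝ} (ht : 0 < t) :
    transmit f t ξ = 1 / (4 * Real.pi) * (1 / Real.pi) ^ ((n - 2) / 2)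
      * signalOp n (iteratedDeriv ((n - 2) / 2) (rootMean f ξ)) (t ^ 2) := by
  set k := (n - 2) / 2 with hk
  have hφ : (fun s => sphericalMean f √(t ^ 2 - s) ξ / (2 * √(t ^ 2 - s)))
      = fun s => 1 / 2 * rootMean f ξ (t ^ 2 - s) := by
    funext s
    rw [rootMean, mul_comm 2, ← div_div]
    ring
  have hpow : (1 / Real.pi) ^ k = (-1 / Real.pi) ^ k * (-1) ^ k := by
    rw [← mul_pow]
    congr 1
    ring
  rw [transmit, if_pos ht, propagatorKernel, hφ, signalOp, ← hk, hpow]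
  simp only [iteratedDeriv_const_mul_comp_sub]
  split_ifs
  · rw [sub_zero]
    ring
  · rw [abel]
    simp only [mul_div_assoc]
    rw [integral_const_mul, integral_const_mul]
    ring

/-- With `σ = t²`, `∂_t = 2t ∂_σ`, so `(2/t) ∂_t = 4 ∂_σ` and `F = -8t ∂_σ²`; differentiation
commutes with `signalOp`. -/
theorem filteredSignal_eq (hf : ContDiff ℝ ∞ f) (hfc : HasCompactSupport f) (hξ : ξ ∉ tsupport f)
    {t : ℝ} (ht : 0 < t) : filteredSignal f t ξ
      = -8 * t * (1 / (4 * Real.pi) * (1 / Real.pi) ^ ((n - 2) / 2)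
        * signalOp n (iteratedDeriv (2 + (n - 2) / 2) (rootMean f ξ)) (t ^ 2)) := by
  have hg := contDiff_rootMean hf hξ
  have hgc := hasCompactSupport_rootMean hfc ξ
  set k := (n - 2) / 2 with hk
  set c := 1 / (4 * Real.pi) * (1 / Real.pi) ^ k with hc
  have hA : ∀ (j : ℕ) (s : ℝ), HasDerivAt (fun s => signalOp n (iteratedDeriv j (rootMean f ξ)) (s ^ 2))
      (signalOp n (iteratedDeriv (j + 1) (rootMean f ξ)) (s ^ 2) * (2 * s)) s := by
    intro j s
    have h := (hasDerivAt_signalOp n (contDiff_infty_iteratedDeriv hg j)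
      (hasCompactSupport_iteratedDeriv hgc j) (s ^ 2)).comp s (hasDerivAt_pow 2 s)
    rw [← iteratedDeriv_succ] at h
    exact h.congr_deriv (by simp)
  have h1 : ∀ s > 0, 2 / s * deriv (fun s => transmit f s ξ) s
      = 4 * c * signalOp n (iteratedDeriv (k + 1) (rootMean f ξ)) (s ^ 2) := by
    intro s hs
    have hev : (fun s => transmit f s ξ) =ᶠ[𝓝 s]
        fun s => c * signalOp n (iteratedDeriv k (rootMean f ξ)) (s ^ 2) := by
      filter_upwards [lt_mem_nhds hs] with r hr using transmit_eq f ξ hr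
    rw [hev.deriv_eq, ((hA k s).const_mul c).deriv]
    have : s ≠ 0 := ne_of_gt hs
    field_simp
    ring
  have hev : (fun s => 2 / s * deriv (fun s => transmit f s ξ) s) =ᶠ[𝓝 t]
      fun s => 4 * c * signalOp n (iteratedDeriv (k + 1) (rootMean f ξ)) (s ^ 2) := by
    filter_upwards [lt_mem_nhds ht] with s hs using h1 s hs
  rw [filteredSignal, filtration, hev.deriv_eq, ((hA (k + 1) t).const_mul (4 * c)).deriv,
    show k + 1 + 1 = 2 + k by ring]
  ring

/-- The retransmitted signal as the value of the kernel on a translate of the profile. -/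
theorem propagatorIntegral_filteredSignal (hf : ContDiff ℝ ∞ f) (hfc : HasCompactSupport f)
    (hξ : ξ ∉ tsupport f) {z : Euc n} (hz : z ≠ 0) :
    propagatorIntegral n (fun t => reversal (filteredSignal f) (-t) ξ) z
      = propagatorKernel n (fun s => -4 * (1 / (4 * Real.pi) * (1 / Real.pi) ^ ((n - 2) / 2))
        * signalOp n (iteratedDeriv (2 + (n - 2) / 2) (rootMean f ξ)) (‖z‖ ^ 2 + s)) := by
  have hz' : 0 < ‖z‖ := norm_pos_iff.2 hz
  refine propagatorKernel_congr n (a := -‖z‖ ^ 2) (by simpa using pow_pos hz' 2) fun s hs => ?_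
  have hpos : 0 < ‖z‖ ^ 2 + s := by linarith
  have hsq : 0 < √(‖z‖ ^ 2 + s) := Real.sqrt_pos.2 hpos
  simp only [reversal, neg_neg]
  rw [filteredSignal_eq hf hfc hξ hsq, Real.sq_sqrt hpos.le]
  field_simp
  ring

/-- With `n = 2k + 3`, the `k` derivatives of transmission, 2 of filtration and `k` of
retransmission make `n - 1`. The constant is `1 / (2 j^(n-1))`, which the factor `-2p` turns into
that of (A). -/
theorem propagatorIntegral_of_odd (hf : ContDiff ℝ ∞ f) (hfc : HasCompactSupport f)
    (hξ : ξ ∉ tsupport f) (hn : 2 ≤ n) (hodd : Odd n) {z : Euc n} (hz : z ≠ 0) :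
    propagatorIntegral n (fun t => reversal (filteredSignal f) (-t) ξ) z
      = (1 / 2 * (1 / (-(2 * Real.pi) ^ 2)) ^ ((n - 2) / 2 + 1)) * filteredData f ξ ‖z‖ := by
  have hz' : 0 < ‖z‖ := norm_pos_iff.2 hz
  rw [propagatorIntegral_filteredSignal hf hfc hξ hz, filteredData_eq hf hξ hz', propagatorKernel,
    if_pos hodd, iteratedDeriv_const_mul_comp_add, signalOp, if_pos hodd,
    iteratedDeriv_iteratedDeriv_add, add_zero]
  obtain ⟨m, hm⟩ := hodd
  obtain ⟨k, hk⟩ : ∃ k, n = 2 * k + 3 := ⟨m - 1, by omega⟩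
  rw [show (n - 2) / 2 = k by omega, show n - 1 = k + (2 + k) by omega]
  generalize iteratedDeriv (k + (2 + k)) (rootMean f ξ) (‖z‖ ^ 2) = X
  have hpi : Real.pi ≠ 0 := Real.pi_ne_zero
  rw [show (2 : ℝ) ^ (k + (2 + k)) = (2 ^ 2) ^ (k + 1) by rw [← pow_mul]; congr 1; ring,
    show (1 / (-(2 * Real.pi) ^ 2) : ℝ) = -1 / Real.pi * (1 / Real.pi) * (1 / 2 ^ 2) by
      field_simp, mul_pow, mul_pow, one_div_pow (2 ^ 2 : ℝ)]
  simp only [neg_div, one_div, mul_inv]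
  generalize Real.pi⁻¹ = w
  field_simp
  ring

/-- The principal value exists on the mirror, and equals the half-order integrals of the profile. -/
theorem tendsto_truncatedIntegral_filteredData (hf : ContDiff ℝ ∞ f) (hfc : HasCompactSupport f)
    (hξ : ξ ∉ tsupport f) (ρ : ℝ) :
    Tendsto (truncatedIntegral (filteredData f ξ) ρ) (𝓝[>] (0 : ℝ))
      (𝓝 (2 ^ (n - 1) * ∫ s in Ioi (0 : ℝ),
        abel (deriv (iteratedDeriv (n - 1) (rootMean f ξ))) (ρ ^ 2 + s) / √s)) := by
  set h := iteratedDeriv (n - 1) (rootMean f ξ) with hh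
  have hhs : ContDiff ℝ ∞ h := contDiff_infty_iteratedDeriv (contDiff_rootMean hf hξ) _
  have hhc : HasCompactSupport h :=
    hasCompactSupport_iteratedDeriv (hasCompactSupport_rootMean hfc ξ) _
  have hs : ContDiff ℝ ∞ (fun y => h (ρ ^ 2 + y)) := hhs.comp (contDiff_const.add contDiff_id)
  have hc : HasCompactSupport (fun y => h (ρ ^ 2 + y)) :=
    hhc.comp_homeomorph (Homeomorph.addLeft (ρ ^ 2))
  have habel : ∀ s, abel (deriv h) (ρ ^ 2 + s) = abel (deriv fun y => h (ρ ^ 2 + y)) s := by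
    intro s
    simp only [abel, deriv_comp_const_add, add_sub_assoc]
  simp only [habel]
  rw [integral_abel_deriv hs hc]
  refine ((tendsto_integral_truncated hs hc).const_mul _).congr fun ε => ?_
  exact (truncatedIntegral_eq (fun r hr => filteredData_eq hf hξ hr)
    (fun y hy => iteratedDeriv_rootMean_of_nonpos hξ _ hy) ρ ε).symm

/-- With `n = 2k + 2` there are `2k + 2 = n` derivatives, one more than in the filtered data; the
extra one is consumed by the two half-order integrals. The constant is `1 / j^n`. -/
theorem propagatorIntegral_of_even (hf : ContDiff ℝ ∞ f) (hfc : HasCompactSupport f)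
    (hξ : ξ ∉ tsupport f) (hn : 2 ≤ n) (heven : Even n) {z : Euc n} (hz : z ≠ 0) :
    propagatorIntegral n (fun t => reversal (filteredSignal f) (-t) ξ) z
      = (1 / (-(2 * Real.pi) ^ 2)) ^ ((n - 2) / 2 + 1)
        * principalValue (filteredData f ξ) ‖z‖ := by
  have hnodd : ¬ Odd n := Nat.not_odd_iff_even.2 heven
  have hg := contDiff_rootMean hf hξ
  have hgc := hasCompactSupport_rootMean hfc ξ
  rw [propagatorIntegral_filteredSignal hf hfc hξ hz, principalValue,
    (tendsto_truncatedIntegral_filteredData hf hfc hξ ‖z‖).limUnder_eq, propagatorKernel,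
    if_neg hnodd, signalOp, if_neg hnodd, ← iteratedDeriv_succ]
  simp only [iteratedDeriv_const_mul_comp_add]
  rw [iteratedDeriv_abel _ (contDiff_infty_iteratedDeriv hg _)
    (hasCompactSupport_iteratedDeriv hgc _), iteratedDeriv_iteratedDeriv_add]
  simp only [mul_div_assoc]
  rw [integral_const_mul]
  obtain ⟨m, hm⟩ := heven
  obtain ⟨k, hk⟩ : ∃ k, n = 2 * k + 2 := ⟨m - 1, by omega⟩
  rw [show (n - 2) / 2 = k by omega, show n - 1 + 1 = k + (2 + k) by omega,
    show n - 1 = 2 * k + 1 by omega]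
  generalize ∫ s in Ioi (0 : ℝ), abel (iteratedDeriv (k + (2 + k)) (rootMean f ξ)) (‖z‖ ^ 2 + s) / √s
    = X
  have hpi : Real.pi ≠ 0 := Real.pi_ne_zero
  rw [pow_succ (2 : ℝ), pow_mul,
    show (1 / (-(2 * Real.pi) ^ 2) : ℝ) = -1 / Real.pi * (1 / Real.pi) * (1 / 2 ^ 2) by
      field_simp, mul_pow, mul_pow, one_div_pow (2 ^ 2 : ℝ)]
  simp only [neg_div, one_div, mul_inv]
  generalize Real.pi⁻¹ = w
  field_simp
  ring

/-! ### The equivalence -/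

/-- Proportionality on `Z` suffices, with no integrability to check, since a constant always leaves
the Bochner integral. -/
theorem integralForm_const_mul {p : MvPolynomial (Fin n) ℝ} {H : Set (Euc n)}
    (hZ : MeasurableSet (zeroSet p)) {φ ψ : Euc n → ℝ} (c : ℝ)
    (h : ∀ ξ ∈ zeroSet p, φ ξ = c * ψ ξ) : integralForm p H φ = c * integralForm p H ψ := by
  rw [integralForm, integralForm, ← integral_const_mul]
  refine setIntegral_congr_fun hZ fun ξ hξ => ?_
  rw [h ξ hξ, mul_assoc]

theorem jConst_pow (k : ℕ) :
    jConst ^ (2 * (k + 1)) = (((-(2 * Real.pi) ^ 2) ^ (k + 1) : ℝ) : ℂ) := by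
  rw [pow_mul, show jConst ^ 2 = ((-(2 * Real.pi) ^ 2 : ℝ) : ℂ) by
    rw [jConst, mul_pow, Complex.I_sq]; push_cast; ring]
  push_cast
  ring

end

end TimeReversal

end

theorem mainTheorem3 (n : ℕ) (hn : 2 ≤ n) (p : MvPolynomial (Fin n) ℝ) (H : Set (Euc n))
    (hcompact : IsCompact (zeroSet p)) (hregular : HasRegularZeroSet p) (hH : IsHyperbolicCavity p H)
    (f : Euc n → ℝ) (hf : ContDiff ℝ ∞ f) (hfc : HasCompactSupport f) (hfH : tsupport f ⊆ H) :
    IsCauchySolution f (transmit f) ∧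
    (Odd n → ∀ x ∈ H, oddInversion p H f x = ((timeReversal p H f x : ℝ) : ℂ)) ∧
    (Even n → ∀ x ∈ H,
      (∀ ξ ∈ zeroSet p, ∃ l : ℝ,
        Tendsto (truncatedIntegral (filteredData f ξ) ‖x - ξ‖) (𝓝[>] (0 : ℝ)) (𝓝 l)) ∧
      evenInversion p H f x = ((timeReversal p H f x : ℝ) : ℂ)) := by
  -- Disjointness of `H` and `Z` keeps mirror points off the support of `f`, so the profiles are
  -- smooth, and ensures `x ≠ ξ` in the retransmission.
  have hdisj : ∀ a ∈ H, a ∉ zeroSet p := fun a ha => (hH.prop.2 a ha).1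
  have hξ : ∀ ξ ∈ zeroSet p, ξ ∉ tsupport f := fun ξ h h' => hdisj ξ (hfH h') h
  have hne : ∀ x ∈ H, ∀ ξ ∈ zeroSet p, x - ξ ≠ 0 := fun x hx ξ h h0 =>
    hdisj x hx (sub_eq_zero.1 h0 ▸ h)
  have hZ : MeasurableSet (zeroSet p) := hcompact.isClosed.measurableSet
  refine ⟨isCauchySolution_transmit hf hn, fun hodd x hx => ?_, fun heven x hx =>
    ⟨fun ξ h => ⟨_, tendsto_truncatedIntegral_filteredData hf hfc (hξ ξ h) _⟩, ?_⟩⟩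
  · have h := integralForm_const_mul (H := H) hZ _ fun ξ h =>
      propagatorIntegral_of_odd hf hfc (hξ ξ h) hn hodd (hne x hx ξ h)
    obtain ⟨m, hm⟩ := hodd
    rw [oddInversion, timeReversal, retransmit, h,
      show jConst ^ (n - 1) = jConst ^ (2 * ((n - 2) / 2 + 1)) by congr 1; omega, jConst_pow,
      one_div_pow]
    push_cast
    ring
  · have h := integralForm_const_mul (H := H) hZ _ fun ξ h =>
      propagatorIntegral_of_even hf hfc (hξ ξ h) hn heven (hne x hx ξ h)
    obtain ⟨m, hm⟩ := heven
    rw [evenInversion, timeReversal, retransmit, h,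
      show jConst ^ n = jConst ^ (2 * ((n - 2) / 2 + 1)) by congr 1; omega, jConst_pow,
      one_div_pow]
    push_cast
    ring
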